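/- Let $(\mathcal M,g,S)$ be a smooth Lorentzian manifold (signature $(-,+,\dots,+)$) of dimension $N>3$ with smooth torsion tensor $S_{\alpha\beta}{}^{\gamma}=-S_{\beta\alpha}{}^{\gamma}$ and metric compatible connection $\nabla$ with coefficients $C_{\alpha\beta}^{\gamma}=\Gamma_{\alpha\beta}^{\gamma}+S_{\alpha\beta}{}^{\gamma}+S^{\gamma}{}_{\alpha\beta}-S_{\beta}{}^{\gamma}{}_{\alpha}$, where $\nabla_\alpha u^\gamma=\partial_\alpha u^\gamma+C^\gamma_{\alpha\beta}u^\beta$ and $\Gamma$ is the Levi-Civita connection of $g$. Let $R_{\alpha\beta}=\partial_\gamma C^\gamma_{\alpha\beta}-\partial_\alpha C^\gamma_{\gamma\beta}+C^\gamma_{\gamma\sigma}C^\sigma_{\alpha\beta}-C^\gamma_{\alpha\sigma}C^\sigma_{\gamma\beta}$ be its Ricci tensor, $R$ its trace, and suppose that for some tensor field $\mathcal T$ and $\Lambda\in\mathbb R$ $$R_{\alpha\beta}-\tfrac12 g_{\alpha\beta}R=8\pi\mathcal T_{\alpha\beta}-g_{\alpha\beta}\Lambda .$$ (The second Einstein--Cartan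 equation, which only expresses the hypermomentum algebraically through $S$, is not needed.) Let $(x^0,x^1,\dots,x^{N-1})$ be local coordinates in which the slices $x^0=\mathrm{const}$ are spacelike, let $e_a=\partial_a$ ($a=1,\dots,N-1$), let $n$ be a smooth unit normal of the slices ($n_\alpha n^\alpha=-1$), and define the lapse $\mathsf N$ and the shift $\beta$ by $\partial_0=\mathsf N n+\beta^i e_i$. Latin indices denote components along the $e_a$, raised and lowered with $h_{ab}=g(e_a,e_b)$; an index $0$ on $S$ denotes contraction with $n$. Put $K_{ab}=e_a^\alpha e_b^\beta\nabla_\alpha n_\beta$, $K=K_i{}^i$, $a_b=g(e_b,\nabla_n n)$, $S_a=S_{a00}$, and let $\mathcal L_0=\mathcal L_{\partial_0}-\mathcal L_\beta$. Let $\tilde D$ be the Levi-Civita connection of $h$, and $D$ the induced connection on the slices, i.e. the metric compatible connection with torsion $S_{ab}{}^c$, with contorsion $\mathcal K_{ab}{}^{c}=S_{ab}{}^{c}+S^{c}{}_{ab}-S_b{}^{c}{}_a$. Let $\bar S_{abc}=S_{abc}+\frac{2}{N-2}h_{c[a}S_{b]i}{}^i$ be the traceless part of the induced torsion, $\mathcal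 T_{ab}=\mathcal T(e_a,e_b)$ and $\mathcal T=g^{\alpha\beta}\mathcal T_{\alpha\beta}$. If $S_{ab0}=0$ identically, then the trace $S_{ai}{}^i$ satisfies the constraint $$\tilde D^a\tilde D_aS_{bi}{}^i-D_bD^aS_{ai}{}^i+\tfrac{N-2}{N-3}\bigl(D^aD_i\bar S_{ab}{}^i-D^aD_{[a}a_{b]}\bigr)+F_b=\tfrac{N-2}{N-3}\,8\pi D^a\mathcal T_{[ab]}+8\pi S^{ji}{}_i\mathcal T_{bj}+S_{bi}{}^i\Bigl(\tfrac{2}{N-2}\Lambda-\tfrac{8\pi}{N-2}\mathcal T\Bigr),$$ where $$\begin{aligned}F_b={}&\Bigl(K_{ab}K-2K^i{}_aK_{bi}-a_aa_b+2a_aS_b-2S_{0ai}K_b{}^i-D_ba_a+\tfrac1{\mathsf N}\mathcal L_0K_{ab}\Bigr)S^{ai}{}_i\\&+\tfrac{N-2}{N-3}D^a\Bigl(2S_{ab}{}^jS_{ji}{}^i+2S_{[a}a_{b]}+2S_{0[a|i}K_{|b]}{}^i\Bigr)-2\mathcal K_{kb}{}^jS^{kc}{}_cS_{ji}{}^i-\mathcal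 K_{cbk}\mathcal K^{ckj}S_{ji}{}^i\\&-2S^{jk}{}_kD_jS_{bi}{}^i-\mathcal K_{kb}{}^jD^kS_{ji}{}^i-2S_b{}^{jk}D_kS_{ji}{}^i-D^a\bigl(\mathcal K_{ab}{}^jS_{ji}{}^i\bigr).\end{aligned}$$ Moreover $F_b$ contains only derivatives of first order: its value at a point is determined by the values and first derivatives at that point of the fields $h_{ab},K_{ab},S_{ab}{}^c,S_{0ab},S_a,a_a,\mathsf N,\beta^a$. -/

import Mathlib

open scoped Manifold ContDiff

noncomputable section

namespace EinsteinCartan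

/-! ### Tensor calculus in components

Everything in this section is relative to a finite set `ι` of indices, a set `X` of points and
"partial derivatives" `D i`, `i : ι`, of real functions on `X`. It is used twice: for the spacetime
(all coordinate directions) and for the slices (only the directions tangent to the slices).
Components: `C x a b c` is `C_{ab}^c`, `S x a b c` is `S_{ab}^c`. -/

section Components

variable {ι X : Type*} [Fintype ι] [DecidableEq ι]

/-- Levi-Civita connection `Γ_{ab}^c` of the metric `g_{ab}`. -/
def christoffel (D : ι → (X → ℝ) → X → ℝ) (g : X → Matrix ι ι ℝ) (x : X) (a b c : ι) : ℝ :=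
  (1 / 2) * ∑ s, (g x)⁻¹ c s *
    (D a (fun y => g y s b) x + D b (fun y => g y a s) x - D s (fun y => g y a b) x)

/-- `S_{abc} = g_{cs} S_{ab}^s`. -/
def lowerTorsion (g : X → Matrix ι ι ℝ) (S : X → ι → ι → ι → ℝ) (x : X) (a b c : ι) : ℝ :=
  ∑ s, g x c s * S x a b s

/-- Contorsion `𝒦_{ab}^c = S_{ab}^c + S^c_{ab} - S_b^c_a`. -/
def contorsion (g : X → Matrix ι ι ℝ) (S : X → ι → ι → ι → ℝ) (x : X) (a b c : ι) : ℝ :=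
  S x a b c + ∑ s, (g x)⁻¹ c s * lowerTorsion g S x s a b
    - ∑ s, (g x)⁻¹ c s * lowerTorsion g S x b s a

/-- The metric compatible connection with torsion `S`: `C_{ab}^c = Γ_{ab}^c + 𝒦_{ab}^c`. -/
def connection (D : ι → (X → ℝ) → X → ℝ) (g : X → Matrix ι ι ℝ) (S : X → ι → ι → ι → ℝ)
    (x : X) (a b c : ι) : ℝ :=
  christoffel D g x a b c + contorsion g S x a b c

/-- `∇_a u^b = ∂_a u^b + C_{ac}^b u^c`. -/
def covVec (D : ι → (X → ℝ) → X → ℝ) (C : X → ι → ι → ι → ℝ) (u : X → ι → ℝ)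
    (x : X) (a b : ι) : ℝ :=
  D a (fun y => u y b) x + ∑ c, C x a c b * u x c

/-- `∇_a ψ_b = ∂_a ψ_b - C_{ab}^c ψ_c`. -/
def cov1 (D : ι → (X → ℝ) → X → ℝ) (C : X → ι → ι → ι → ℝ) (ψ : X → ι → ℝ)
    (x : X) (a b : ι) : ℝ :=
  D a (fun y => ψ y b) x - ∑ c, C x a b c * ψ x c

/-- `∇_a ψ_{bc}`. -/
def cov2 (D : ι → (X → ℝ) → X → ℝ) (C : X → ι → ι → ι → ℝ) (ψ : X → ι → ι → ℝ)
    (x : X) (a b c : ι) : ℝ :=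
  D a (fun y => ψ y b c) x - ∑ e, C x a b e * ψ x e c - ∑ e, C x a c e * ψ x b e

/-- `∇_a ψ_{bce}`. -/
def cov3 (D : ι → (X → ℝ) → X → ℝ) (C : X → ι → ι → ι → ℝ) (ψ : X → ι → ι → ι → ℝ)
    (x : X) (a b c e : ι) : ℝ :=
  D a (fun y => ψ y b c e) x - ∑ f, C x a b f * ψ x f c e - ∑ f, C x a c f * ψ x b f e
    - ∑ f, C x a e f * ψ x b c f

/-- `∇^a ψ_a`. -/
def div1 (D : ι → (X → ℝ) → X → ℝ) (g : X → Matrix ι ι ℝ) (C : X → ι → ι → ι → ℝ)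
    (ψ : X → ι → ℝ) (x : X) : ℝ :=
  ∑ a, ∑ c, (g x)⁻¹ a c * cov1 D C ψ x c a

/-- `∇^a ψ_{ab}`. -/
def div2 (D : ι → (X → ℝ) → X → ℝ) (g : X → Matrix ι ι ℝ) (C : X → ι → ι → ι → ℝ)
    (ψ : X → ι → ι → ℝ) (x : X) (b : ι) : ℝ :=
  ∑ a, ∑ c, (g x)⁻¹ a c * cov2 D C ψ x c a b

/-- Curvature `R_{abc}^e = ∂_b C_{ac}^e - ∂_a C_{bc}^e + C_{bs}^e C_{ac}^s - C_{as}^e C_{bc}^s`. -/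
def riemann (D : ι → (X → ℝ) → X → ℝ) (C : X → ι → ι → ι → ℝ) (x : X) (a b c e : ι) : ℝ :=
  D b (fun y => C y a c e) x - D a (fun y => C y b c e) x
    + ∑ s, (C x b s e * C x a c s - C x a s e * C x b c s)

/-- Ricci tensor `R_{ab} = R_{acb}^c`. -/
def ricci (D : ι → (X → ℝ) → X → ℝ) (C : X → ι → ι → ι → ℝ) (x : X) (a b : ι) : ℝ :=
  ∑ c, riemann D C x a c b c

/-- Trace `g^{ab} ψ_{ab}`. -/
def trace2 (g : X → Matrix ι ι ℝ) (ψ : X → ι → ι → ℝ) (x : X) : ℝ :=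
  ∑ a, ∑ b, (g x)⁻¹ a b * ψ x a b

/-- Einstein tensor `G_{ab} = R_{ab} - g_{ab} R / 2`. -/
def einstein (D : ι → (X → ℝ) → X → ℝ) (g : X → Matrix ι ι ℝ) (C : X → ι → ι → ι → ℝ)
    (x : X) (a b : ι) : ℝ :=
  ricci D C x a b - (1 / 2) * g x a b * trace2 g (ricci D C) x

/-- `ψ_{[ab]}`. -/
def asym (ψ : X → ι → ι → ℝ) (x : X) (a b : ι) : ℝ := (1 / 2) * (ψ x a b - ψ x b a)

/-- `ψ^a = g^{ab} ψ_b`. -/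
def raise1 (g : X → Matrix ι ι ℝ) (ψ : X → ι → ℝ) (x : X) (a : ι) : ℝ :=
  ∑ b, (g x)⁻¹ a b * ψ x b

/-- `ψ_a^b = g^{bc} ψ_{ac}`. -/
def raise2 (g : X → Matrix ι ι ℝ) (ψ : X → ι → ι → ℝ) (x : X) (a b : ι) : ℝ :=
  ∑ c, (g x)⁻¹ b c * ψ x a c

end Components

/-! ### Coordinates, partial derivatives -/

/-- Coordinates `(x^0, x^1, …, x^d)` of a spacetime of dimension `N = d + 1`. -/
abbrev Coord (d : ℕ) : Type := EuclideanSpace ℝ (Fin (d + 1))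

/-- `∂_μ`. -/
def pd {d : ℕ} (μ : Fin (d + 1)) (f : Coord d → ℝ) (x : Coord d) : ℝ :=
  fderiv ℝ f x (EuclideanSpace.single μ 1)

/-- `∂_a` for the directions `a = 1, …, d` tangent to the slices `x^0 = const`. -/
def spd {d : ℕ} (a : Fin d) (f : Coord d → ℝ) (x : Coord d) : ℝ := pd a.succ f x

/-! ### The fields on the slices `x^0 = const` and the 1-form `F` -/

/-- The fields of the slices, as functions of the spacetime coordinates. -/
structure SliceFields (d : ℕ) where
  /-- induced metric `h_{ab}` -/
  h : Coord d → Matrix (Fin d) (Fin d) ℝ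
  /-- second fundamental form `K_{ab}` -/
  K : Coord d → Fin d → Fin d → ℝ
  /-- induced torsion `S_{ab}^c` -/
  S : Coord d → Fin d → Fin d → Fin d → ℝ
  /-- `S_{0ab}` -/
  S0 : Coord d → Fin d → Fin d → ℝ
  /-- `S_a = S_{a00}` -/
  Sn : Coord d → Fin d → ℝ
  /-- acceleration `a_b` -/
  acc : Coord d → Fin d → ℝ
  /-- lapse -/
  lapse : Coord d → ℝ
  /-- shift `β^a` -/
  shift : Coord d → Fin d → ℝ

namespace SliceFields

variable {d : ℕ} (P : SliceFields d)

/-- Levi-Civita connection of `h`, the coefficients of `D̃`. -/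
def leviCivita : Coord d → Fin d → Fin d → Fin d → ℝ := christoffel spd P.h

/-- Induced contorsion `𝒦_{ab}^c`. -/
def contor : Coord d → Fin d → Fin d → Fin d → ℝ := contorsion P.h P.S

/-- Induced connection with torsion, the coefficients of `D`. -/
def conn : Coord d → Fin d → Fin d → Fin d → ℝ := connection spd P.h P.S

/-- The trace `S_{ai}^i`. -/
def trS (x : Coord d) (a : Fin d) : ℝ := ∑ i, P.S x a i i

/-- The traceless part `S̄_{abc} = S_{abc} + (2 / (N - 2)) h_{c[a} S_{b]i}^i`, `N = d + 1`. -/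
def tracelessS (x : Coord d) (a b c : Fin d) : ℝ :=
  lowerTorsion P.h P.S x a b c
    + 1 / (((d + 1 : ℕ) : ℝ) - 2) * (P.h x c a * P.trS x b - P.h x c b * P.trS x a)

/-- `D̃^a D̃_a S_{bi}^i`. -/
def laplaceTrS (x : Coord d) (b : Fin d) : ℝ :=
  div2 spd P.h P.leviCivita (cov1 spd P.leviCivita P.trS) x b

/-- `D_b D^a S_{ai}^i`. -/
def gradDivTrS (x : Coord d) (b : Fin d) : ℝ :=
  spd b (div1 spd P.h P.conn P.trS) x

/-- `D_i S̄_{ab}^i`. -/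
def divTracelessS (x : Coord d) (a b : Fin d) : ℝ :=
  ∑ i, ∑ j, (P.h x)⁻¹ i j * cov3 spd P.conn P.tracelessS x i a b j

/-- `ℒ_0 K_{ab} = (ℒ_t - ℒ_β) K_{ab}` where `t = ∂_0`. -/
def lieZeroK (x : Coord d) (a b : Fin d) : ℝ :=
  pd 0 (fun y => P.K y a b) x
    - ∑ i, (P.shift x i * spd i (fun y => P.K y a b) x
      + P.K x i b * spd a (fun y => P.shift y i) x
      + P.K x a i * spd b (fun y => P.shift y i) x)

/-- `K_{ab} K - 2 K^i_a K_{bi} - a_a a_b + 2 a_a S_b - 2 S_{0ai} K_b^i - D_b a_a + ℒ_0 K_{ab} / N`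
(`N` the lapse). -/
def bracket (x : Coord d) (a b : Fin d) : ℝ :=
  P.K x a b * trace2 P.h P.K x
    - 2 * ∑ i, ∑ j, (P.h x)⁻¹ i j * P.K x j a * P.K x b i
    - P.acc x a * P.acc x b + 2 * P.acc x a * P.Sn x b
    - 2 * ∑ i, P.S0 x a i * raise2 P.h P.K x b i
    - cov1 spd P.conn P.acc x b a
    + 1 / P.lapse x * P.lieZeroK x a b

/-- `2 S_{ab}^j S_{ji}^i + 2 S_{[a} a_{b]} + 2 S_{0[a|i} K_{|b]}^i`. -/
def inner (x : Coord d) (a b : Fin d) : ℝ :=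
  2 * ∑ j, P.S x a b j * P.trS x j
    + (P.Sn x a * P.acc x b - P.Sn x b * P.acc x a)
    + ∑ i, (P.S0 x a i * raise2 P.h P.K x b i - P.S0 x b i * raise2 P.h P.K x a i)

/-- `𝒦_{ab}^j S_{ji}^i`. -/
def contorTrS (x : Coord d) (a b : Fin d) : ℝ := ∑ j, P.contor x a b j * P.trS x j

/-- The 1-form `F_b`. -/
def F (x : Coord d) (b : Fin d) : ℝ :=
  ∑ a, P.bracket x a b * raise1 P.h P.trS x a
    + (((d + 1 : ℕ) : ℝ) - 2) / (((d + 1 : ℕ) : ℝ) - 3) * div2 spd P.h P.conn P.inner x b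
    - 2 * ∑ k, ∑ j, P.contor x k b j * raise1 P.h P.trS x k * P.trS x j
    - ∑ c, ∑ e, ∑ k, ∑ j,
        (P.h x)⁻¹ c e * P.contor x c b k * P.contor x e k j * P.trS x j
    - 2 * ∑ j, raise1 P.h P.trS x j * cov1 spd P.conn P.trS x j b
    - ∑ k, ∑ l, ∑ j, (P.h x)⁻¹ k l * P.contor x k b j * cov1 spd P.conn P.trS x l j
    - 2 * ∑ j, ∑ l, ∑ k, (P.h x)⁻¹ j l * P.S x b l k * cov1 spd P.conn P.trS x k j
    - div2 spd P.h P.conn P.contorTrS x b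

end SliceFields

/-- `f` and `g` are differentiable at `x` and have there the same value and first derivatives. -/
def SameJet {d : ℕ} (f g : Coord d → ℝ) (x : Coord d) : Prop :=
  DifferentiableAt ℝ f x ∧ DifferentiableAt ℝ g x ∧ f x = g x ∧ fderiv ℝ f x = fderiv ℝ g x

/-- All fields of `P` and `Q` have the same value and the same first derivatives at `x`. -/
structure SliceFields.SameFirstJet {d : ℕ} (P Q : SliceFields d) (x : Coord d) : Prop where
  h : ∀ a b, SameJet (fun y => P.h y a b) (fun y => Q.h y a b) x
  K : ∀ a b, SameJet (fun y => P.K y a b) (fun y => Q.K y a b) x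
  S : ∀ a b c, SameJet (fun y => P.S y a b c) (fun y => Q.S y a b c) x
  S0 : ∀ a b, SameJet (fun y => P.S0 y a b) (fun y => Q.S0 y a b) x
  Sn : ∀ a, SameJet (fun y => P.Sn y a) (fun y => Q.Sn y a) x
  acc : ∀ a, SameJet (fun y => P.acc y a) (fun y => Q.acc y a) x
  lapse : SameJet P.lapse Q.lapse x
  shift : ∀ a, SameJet (fun y => P.shift y a) (fun y => Q.shift y a) x

/-! ### The slice fields of a spacetime in adapted coordinates

`g`, `S` are the components of the metric and of the torsion `S_{αβ}^γ`, `n` those of the unit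
normal `n^α`; the tangent frame is `e_a = ∂_a`. -/

section Slices

variable {d : ℕ} (g : Coord d → Matrix (Fin (d + 1)) (Fin (d + 1)) ℝ)
  (S : Coord d → Fin (d + 1) → Fin (d + 1) → Fin (d + 1) → ℝ)
  (n : Coord d → Fin (d + 1) → ℝ)

/-- `n_α = g_{αβ} n^β`. -/
def normalForm (x : Coord d) (α : Fin (d + 1)) : ℝ := ∑ β, g x α β * n x β

/-- First fundamental form `h_{ab} = g(e_a, e_b)`. -/
def inducedMetric (x : Coord d) : Matrix (Fin d) (Fin d) ℝ := fun a b => g x a.succ b.succ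

/-- Second fundamental form `K_{ab} = e_a^α e_b^β ∇_α n_β`. -/
def secondForm (x : Coord d) (a b : Fin d) : ℝ :=
  cov1 pd (connection pd g S) (normalForm g n) x a.succ b.succ

/-- The components `e^c_γ = h^{ci} g(e_i, ·)_γ` of the projection to the slices. -/
def tangentCoframe (x : Coord d) (c : Fin d) (γ : Fin (d + 1)) : ℝ :=
  ∑ i, (inducedMetric g x)⁻¹ c i * g x i.succ γ

/-- Induced torsion `S_{ab}^c = e_a^α e_b^β e^c_γ S_{αβ}^γ`. -/
def inducedTorsion (x : Coord d) (a b c : Fin d) : ℝ :=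
  ∑ γ, tangentCoframe g x c γ * S x a.succ b.succ γ

/-- `S_{0ab} = n^μ e_a^α e_b^β S_{μαβ}`. -/
def torsion0ab (x : Coord d) (a b : Fin d) : ℝ :=
  ∑ μ, n x μ * lowerTorsion g S x μ a.succ b.succ

/-- `S_{ab0} = e_a^α e_b^β n^γ S_{αβγ}`. -/
def torsionab0 (x : Coord d) (a b : Fin d) : ℝ :=
  ∑ γ, n x γ * lowerTorsion g S x a.succ b.succ γ

/-- `S_a = S_{a00} = e_a^α n^μ n^ν S_{αμν}`. -/
def torsiona00 (x : Coord d) (a : Fin d) : ℝ :=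
  ∑ μ, ∑ ν, n x μ * n x ν * lowerTorsion g S x a.succ μ ν

/-- Acceleration `a_b = g(e_b, ∇_n n)`. -/
def acceleration (x : Coord d) (b : Fin d) : ℝ :=
  ∑ μ, g x b.succ μ * ∑ ν, n x ν * covVec pd (connection pd g S) n x ν μ

/-- The fields induced on the slices. -/
def sliceFields (lapse : Coord d → ℝ) (shift : Coord d → Fin d → ℝ) : SliceFields d where
  h := inducedMetric g
  K := secondForm g S n
  S := inducedTorsion g S
  S0 := torsion0ab g S n
  Sn := torsiona00 g S n
  acc := acceleration g S n
  lapse := lapse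
  shift := shift

/-- `n` is a smooth unit normal to the slices `x^0 = const`, which are spacelike, and the time
vector `t = ∂_0` decomposes as `t^α = lapse n^α + shift^i e_i^α`. -/
structure IsAdapted (U : Set (Coord d)) (lapse : Coord d → ℝ) (shift : Coord d → Fin d → ℝ) :
    Prop where
  spacelike : ∀ x ∈ U, (inducedMetric g x).PosDef
  smooth : ∀ α, ContDiffOn ℝ ∞ (fun x => n x α) U
  orthogonal : ∀ x ∈ U, ∀ a : Fin d, normalForm g n x a.succ = 0
  unit : ∀ x ∈ U, ∑ α, normalForm g n x α * n x α = -1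
  time : ∀ x ∈ U, ∀ α, (Pi.single 0 1 : Fin (d + 1) → ℝ) α
    = lapse x * n x α + (Fin.cons 0 (shift x) : Fin (d + 1) → ℝ) α

end Slices

/-! ### Einstein-Cartan spacetimes -/

section Manifold

variable (d : ℕ) (M : Type*) [TopologicalSpace M] [ChartedSpace (Coord d) M]

/-- Fields of bilinear forms on `M`. -/
abbrev FormField : Type _ :=
  ∀ p : M, TangentSpace (𝓡 (d + 1)) p →L[ℝ] TangentSpace (𝓡 (d + 1)) p →L[ℝ] ℝ

/-- Fields of bilinear maps `T_p M × T_p M → T_p M`. -/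
abbrev BilinField : Type _ :=
  ∀ p : M, TangentSpace (𝓡 (d + 1)) p →L[ℝ] TangentSpace (𝓡 (d + 1)) p →L[ℝ]
    TangentSpace (𝓡 (d + 1)) p

variable {d M}

/-- The coordinate vector `∂_μ` of the chart `φ` at the point with coordinates `x`. -/
def coordVec (φ : OpenPartialHomeomorph M (Coord d)) (x : Coord d) (μ : Fin (d + 1)) :
    TangentSpace (𝓡 (d + 1)) (φ.symm x) :=
  mfderiv (𝓡 (d + 1)) (𝓡 (d + 1)) φ.symm x (EuclideanSpace.single μ (1 : ℝ) : Coord d)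

/-- The components of a field of bilinear forms in the chart `φ`. -/
def formComp (φ : OpenPartialHomeomorph M (Coord d)) (B : FormField d M) (x : Coord d) :
    Matrix (Fin (d + 1)) (Fin (d + 1)) ℝ :=
  fun μ ν => B (φ.symm x) (coordVec φ x μ) (coordVec φ x ν)

/-- The components of the tangent vector `v` at `p` in the chart `φ`. -/
def vecComp (φ : OpenPartialHomeomorph M (Coord d)) (p : M) (v : TangentSpace (𝓡 (d + 1)) p) :
    Coord d :=
  mfderiv (𝓡 (d + 1)) (𝓡 (d + 1)) φ p v

/-- The components `S_{αβ}^γ` of a field of bilinear maps in the chart `φ`. -/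
def bilinComp (φ : OpenPartialHomeomorph M (Coord d)) (S : BilinField d M) (x : Coord d)
    (α β γ : Fin (d + 1)) : ℝ :=
  vecComp φ (φ.symm x) (S (φ.symm x) (coordVec φ x α) (coordVec φ x β)) γ

/-- `g` is a smooth Lorentzian metric of signature `(-, +, …, +)`. -/
structure IsLorentzMetric (g : FormField d M) : Prop where
  symm : ∀ p u v, g p u v = g p v u
  lorentz : ∀ p, ∃ u, g p u u < 0 ∧ ∀ v, g p u v = 0 → v ≠ 0 → 0 < g p v v
  smooth : ∀ φ ∈ IsManifold.maximalAtlas (𝓡 (d + 1)) ∞ M, ∀ μ ν,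
    ContDiffOn ℝ ∞ (fun x => formComp φ g x μ ν) φ.target

/-- `S` is a smooth torsion tensor: a field of antisymmetric bilinear maps. -/
structure IsTorsion (S : BilinField d M) : Prop where
  antisymm : ∀ p u v, S p u v = -S p v u
  smooth : ∀ φ ∈ IsManifold.maximalAtlas (𝓡 (d + 1)) ∞ M, ∀ α β γ,
    ContDiffOn ℝ ∞ (fun x => bilinComp φ S x α β γ) φ.target

/-- The field equations `G_{αβ} = 8π 𝒯_{αβ} - g_{αβ} Λ` for the metric compatible connection with
torsion `S`. (The second field equation, `S^{αβγ} + 2 g^{γ[α} S^{β]}_μ^μ = -8π Δ^{αβγ}`, only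
expresses the hypermomentum `Δ` through the torsion.) -/
def FieldEquations (g : FormField d M) (S : BilinField d M) (T : FormField d M) (Λ : ℝ) : Prop :=
  ∀ φ ∈ IsManifold.maximalAtlas (𝓡 (d + 1)) ∞ M, ∀ x ∈ φ.target, ∀ μ ν,
    einstein pd (formComp φ g) (connection pd (formComp φ g) (bilinComp φ S)) x μ ν
      = 8 * Real.pi * formComp φ T x μ ν - formComp φ g x μ ν * Λ

end Manifold

/-! ### The induced connection is the projection of the spacetime connection -/

section Helper

lemma lower_connection {ι X : Type*} [Fintype ι] [DecidableEq ι]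
    (D : ι → (X → ℝ) → X → ℝ) (g : X → Matrix ι ι ℝ) (S : X → ι → ι → ι → ℝ) (x : X)
    (hg : IsUnit (g x).det) (a b c : ι) :
    ∑ s, g x c s * connection D g S x a b s
      = (1 / 2) * (D a (fun y => g y c b) x + D b (fun y => g y a c) x - D c (fun y => g y a b) x)
        + (lowerTorsion g S x a b c + lowerTorsion g S x c a b - lowerTorsion g S x b c a) := by
  have key : ∀ f : ι → ℝ, ∑ s, g x c s * ∑ t, (g x)⁻¹ s t * f t = f c := by
    intro f
    have h1 : (g x).mulVec ((g x)⁻¹.mulVec f) = f := by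
      rw [Matrix.mulVec_mulVec, Matrix.mul_nonsing_inv _ hg, Matrix.one_mulVec]
    exact congrFun h1 c
  have k1 := key fun s =>
    D a (fun y => g y s b) x + D b (fun y => g y a s) x - D s (fun y => g y a b) x
  have k2 := key fun s => lowerTorsion g S x s a b
  have k3 := key fun s => lowerTorsion g S x b s a
  rw [← k1, ← k2, ← k3]
  simp only [connection, christoffel, contorsion, lowerTorsion, mul_add, mul_sub,
    Finset.sum_add_distrib, Finset.sum_sub_distrib, Finset.mul_sum]
  simp only [mul_left_comm (1 / 2 : ℝ)]

/-- `C_{ab}^c = e_a^α (∇_α e_b^β) e^c_β`, where `∇_α e_b^β = C_{αb}^β` as `e_b = ∂_b`. -/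
theorem conn_eq_projection {d : ℕ} (g : Coord d → Matrix (Fin (d + 1)) (Fin (d + 1)) ℝ)
    (S : Coord d → Fin (d + 1) → Fin (d + 1) → Fin (d + 1) → ℝ) (n : Coord d → Fin (d + 1) → ℝ)
    (lapse : Coord d → ℝ) (shift : Coord d → Fin d → ℝ) (x : Coord d)
    (hg : IsUnit (g x).det) (hh : IsUnit (inducedMetric g x).det) (a b c : Fin d) :
    (sliceFields g S n lapse shift).conn x a b c
      = ∑ β, tangentCoframe g x c β * connection pd g S x a.succ b.succ β := by
  have hlow : ∀ a b c : Fin d, lowerTorsion (inducedMetric g) (inducedTorsion g S) x a b c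
      = lowerTorsion g S x a.succ b.succ c.succ := by
    intro a b c
    have h1 : (inducedMetric g x).mulVec ((inducedMetric g x)⁻¹.mulVec
        (fun i => lowerTorsion g S x a.succ b.succ i.succ)) =
          fun i => lowerTorsion g S x a.succ b.succ i.succ := by
      rw [Matrix.mulVec_mulVec, Matrix.mul_nonsing_inv _ hh, Matrix.one_mulVec]
    rw [← congrFun h1 c]
    simp only [lowerTorsion, Matrix.mulVec, dotProduct, inducedTorsion, tangentCoframe,
      Finset.mul_sum, Finset.sum_mul]
    refine Finset.sum_congr rfl fun s _ => ?_
    rw [Finset.sum_comm]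
    simp only [mul_assoc]
  have hL : ∀ i : Fin d, ∑ s, inducedMetric g x i s * (sliceFields g S n lapse shift).conn x a b s
      = ∑ β, g x i.succ β * connection pd g S x a.succ b.succ β := by
    intro i
    rw [lower_connection pd g S x hg]
    have := lower_connection spd (inducedMetric g) (inducedTorsion g S) x hh a b i
    simp only [hlow] at this
    exact this
  have h2 : (inducedMetric g x)⁻¹.mulVec ((inducedMetric g x).mulVec
      ((sliceFields g S n lapse shift).conn x a b)) = (sliceFields g S n lapse shift).conn x a b := by
    rw [Matrix.mulVec_mulVec, Matrix.nonsing_inv_mul _ hh, Matrix.one_mulVec]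
  rw [← congrFun h2 c]
  simp only [Matrix.mulVec, dotProduct] at hL ⊢
  simp only [hL, tangentCoframe, Finset.mul_sum, Finset.sum_mul]
  rw [Finset.sum_comm]
  simp only [mul_assoc]

end Helper

end EinsteinCartan

end

open scoped Manifold ContDiff

noncomputable section

namespace EinsteinCartan

/-! ### Directional derivatives of smooth functions -/

/-! Write `σ_a = S_{ai}^i` and let `R` be the Ricci tensor of the induced connection `D`. The
constraint is the divergence of the antisymmetric part of the tangential field equations, rearranged
into a second-order operator acting on `σ`.

Two facts about Ricci tensors carry the argument. The contracted first Bianchi identity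
(`ricci_antisymm`) gives `R_{[ab]} = D_i S_{ab}^i + D_a σ_b - D_b σ_a + 2 S_{ab}^j σ_j`. Passing to
the traceless torsion costs `(D_a σ_b - D_b σ_a)/(N-2)`, so the curl of `σ` is left with the
coefficient `1 - 1/(N-2) = (N-3)/(N-2)`; its inverse is the factor in the theorem. The Gauss
equation (`AdaptedFields.ricci_succ`) says that the tangential spacetime Ricci tensor at `(a, b)` is
`R_{ab}` plus `bracket` at `(b, a)`. Since `S_{ab0} = 0` makes `K` and `ℒ_0 K` symmetric, the
antisymmetric part of `bracket` contributes only the acceleration curl and the terms of `inner`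
other than `2 S_{ab}^j σ_j`.

The divergence of the curl is `D^a D_a σ_b - D^a D_b σ_a`. Commuting the derivatives in the second
term (`div2_transpose_cov1`) produces `D_b D^a σ_a`, a torsion term and `R_{bj} σ^j`. The Gauss
equation, used a second time, trades this last term for the spacetime Ricci tensor minus `bracket`.
Replacing `D` by the Levi-Civita derivative in the Laplacian (`div2_christoffel_cov1`) yields the
contorsion terms of `F`. Together these give `ricci_constraint`, which holds without field
equations; they then replace the spacetime Ricci tensor by `𝒯`, `Λ` and the trace of `𝒯`.

For the Gauss equation, `∇_μ e_b` is split into a tangential part and a multiple of `n`. In adapted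
coordinates a vector is tangent to the slices exactly when its `0`-component vanishes, and `n_α` has
only a `0`-component, so the splitting can be read off from components. The time direction is
handled through `∂_0 = N n + β^i e_i` and the torsion relation `∇_0 e_b - ∇_b ∂_0 = 2 S(∂_0, e_b)`.

The tensor identities are proved for `dirDeriv v` with constant directions `v`; `pd` and `spd` are
definitionally the cases `coordDir` and `sliceDir`. On the slices `x^0` is a mere parameter.

The last claim holds because every derivative in `F` falls once on an expression algebraic in the
listed fields, while connection coefficients enter undifferentiated. -/

section Calculus

variable {ι E : Type*} [NormedAddCommGroup E] [NormedSpace ℝ E]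

/-- The derivative in the direction of the constant vector `v i`. -/
def dirDeriv (v : ι → E) (i : ι) (f : E → ℝ) (x : E) : ℝ := fderiv ℝ f x (v i)

/-- `f` is smooth on `U`. -/
def SmoothOn (U : Set E) (f : E → ℝ) : Prop := ContDiffOn ℝ ∞ f U

namespace SmoothOn

variable {U : Set E} {f g : E → ℝ}

lemma differentiableAt (hf : SmoothOn U f) (hU : IsOpen U) {x : E} (hx : x ∈ U) :
    DifferentiableAt ℝ f x :=
  (ContDiffOn.contDiffAt hf (hU.mem_nhds hx)).differentiableAt (by simp)

lemma const (c : ℝ) : SmoothOn U (fun _ => c) := contDiffOn_const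

lemma add (hf : SmoothOn U f) (hg : SmoothOn U g) : SmoothOn U fun x => f x + g x :=
  ContDiffOn.add hf hg

lemma sub (hf : SmoothOn U f) (hg : SmoothOn U g) : SmoothOn U fun x => f x - g x :=
  ContDiffOn.sub hf hg

lemma mul (hf : SmoothOn U f) (hg : SmoothOn U g) : SmoothOn U fun x => f x * g x :=
  ContDiffOn.mul hf hg

lemma inv (hf : SmoothOn U f) (h0 : ∀ x ∈ U, f x ≠ 0) : SmoothOn U fun x => (f x)⁻¹ :=
  ContDiffOn.inv hf h0

lemma sum {κ : Type*} {s : Finset κ} {F : κ → E → ℝ} (hF : ∀ k, SmoothOn U (F k)) :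
    SmoothOn U fun x => ∑ k ∈ s, F k x :=
  ContDiffOn.sum fun k _ => hF k

lemma prod {κ : Type*} {s : Finset κ} {F : κ → E → ℝ} (hF : ∀ k, SmoothOn U (F k)) :
    SmoothOn U fun x => ∏ k ∈ s, F k x :=
  contDiffOn_prod fun k _ => hF k

lemma congr (hf : SmoothOn U f) (h : ∀ x ∈ U, g x = f x) : SmoothOn U g :=
  ContDiffOn.congr hf h

lemma dirDeriv (hf : SmoothOn U f) (hU : IsOpen U) (v : ι → E) (i : ι) :
    SmoothOn U (dirDeriv v i f) :=
  (hf.fderiv_of_isOpen hU (by simp)).clm_apply contDiffOn_const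

end SmoothOn

/-! ### Rules for directional derivatives -/

section Rules

variable (v : ι → E) (i : ι) {f g : E → ℝ} {x : E}

lemma dirDeriv_const (c : ℝ) : dirDeriv v i (fun _ => c) x = 0 := by
  simp [dirDeriv]

lemma dirDeriv_add (hf : DifferentiableAt ℝ f x) (hg : DifferentiableAt ℝ g x) :
    dirDeriv v i (fun y => f y + g y) x = dirDeriv v i f x + dirDeriv v i g x := by
  simp [dirDeriv, fderiv_fun_add hf hg]

lemma dirDeriv_sub (hf : DifferentiableAt ℝ f x) (hg : DifferentiableAt ℝ g x) :
    dirDeriv v i (fun y => f y - g y) x = dirDeriv v i f x - dirDeriv v i g x := by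
  simp [dirDeriv, fderiv_fun_sub hf hg]

lemma dirDeriv_mul (hf : DifferentiableAt ℝ f x) (hg : DifferentiableAt ℝ g x) :
    dirDeriv v i (fun y => f y * g y) x = dirDeriv v i f x * g x + f x * dirDeriv v i g x := by
  simp [dirDeriv, fderiv_fun_mul hf hg]
  ring

lemma dirDeriv_const_mul (c : ℝ) (hf : DifferentiableAt ℝ f x) :
    dirDeriv v i (fun y => c * f y) x = c * dirDeriv v i f x := by
  simp [dirDeriv, fderiv_const_mul hf]

lemma dirDeriv_sum {κ : Type*} {s : Finset κ} {F : κ → E → ℝ}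
    (hF : ∀ k, DifferentiableAt ℝ (F k) x) :
    dirDeriv v i (fun y => ∑ k ∈ s, F k y) x = ∑ k ∈ s, dirDeriv v i (F k) x := by
  simp [dirDeriv, fderiv_fun_sum fun k _ => hF k]

lemma dirDeriv_sum_mul {κ : Type*} {s : Finset κ} {F G : κ → E → ℝ}
    (hF : ∀ k, DifferentiableAt ℝ (F k) x) (hG : ∀ k, DifferentiableAt ℝ (G k) x) :
    dirDeriv v i (fun y => ∑ k ∈ s, F k y * G k y) x
      = ∑ k ∈ s, dirDeriv v i (F k) x * G k x + ∑ k ∈ s, F k x * dirDeriv v i (G k) x := by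
  rw [dirDeriv_sum v i (F := fun k y => F k y * G k y) fun k => (hF k).mul (hG k),
    ← Finset.sum_add_distrib]
  exact Finset.sum_congr rfl fun k _ => dirDeriv_mul v i (hF k) (hG k)

lemma dirDeriv_congr {U : Set E} (hU : IsOpen U) (hx : x ∈ U) (h : ∀ y ∈ U, f y = g y) :
    dirDeriv v i f x = dirDeriv v i g x := by
  have : f =ᶠ[nhds x] g := Filter.eventually_of_mem (hU.mem_nhds hx) h
  rw [dirDeriv, dirDeriv, this.fderiv_eq]

lemma dirDeriv_comm {U : Set E} (hU : IsOpen U) (hx : x ∈ U) (hf : SmoothOn U f) (j : ι) :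
    dirDeriv v i (dirDeriv v j f) x = dirDeriv v j (dirDeriv v i f) x := by
  have hd : DifferentiableAt ℝ (fderiv ℝ f) x :=
    ((hf.fderiv_of_isOpen hU (m := ∞) (by simp)).contDiffAt (hU.mem_nhds hx)).differentiableAt
      (by simp)
  have key : ∀ k l, dirDeriv v k (dirDeriv v l f) x = fderiv ℝ (fderiv ℝ f) x (v k) (v l) := by
    intro k l
    change fderiv ℝ (fun y => fderiv ℝ f y (v l)) x (v k) = _
    rw [fderiv_clm_apply hd (by fun_prop)]
    simp
  rw [key, key]
  have := (ContDiffOn.contDiffAt hf (hU.mem_nhds hx)).isSymmSndFDerivAt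
    (n := ∞) (by simp only [minSmoothness_of_isRCLikeNormedField]; exact WithTop.coe_le_coe.2 (le_top : (2 : ℕ∞) ≤ ⊤))
  exact this _ _

end Rules

/-! ### Smoothness of the inverse metric -/

section Inverse

variable [Fintype ι] [DecidableEq ι] {U : Set E} {h : E → Matrix ι ι ℝ}

lemma SmoothOn.det (hh : ∀ a b, SmoothOn U fun y => h y a b) : SmoothOn U fun y => (h y).det := by
  simp only [Matrix.det_apply']
  exact .sum fun σ => (SmoothOn.const _).mul (.prod fun k => hh _ _)

/-- Cramer's rule: the entries of the adjugate are determinants of the matrix with one row replaced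
by a constant row. -/
lemma SmoothOn.matrix_inv (hh : ∀ a b, SmoothOn U fun y => h y a b)
    (h0 : ∀ x ∈ U, IsUnit (h x).det) (a b : ι) : SmoothOn U fun y => (h y)⁻¹ a b := by
  simp only [Matrix.inv_def, Matrix.smul_apply, smul_eq_mul, Ring.inverse_eq_inv',
    Matrix.adjugate_apply]
  refine ((SmoothOn.det hh).inv fun x hx => (h0 x hx).ne_zero).mul (SmoothOn.det fun c e => ?_)
  by_cases hc : c = b
  · subst hc
    simpa only [Matrix.updateRow_self] using SmoothOn.const _
  · simpa only [Matrix.updateRow_ne hc] using hh c e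

end Inverse

end Calculus

/-! ### Metric compatible connections -/

section Compatible

variable {ι X : Type*} [Fintype ι] [DecidableEq ι] {D : ι → (X → ℝ) → X → ℝ}
  {h : X → Matrix ι ι ℝ} {S C : X → ι → ι → ι → ℝ} {x : X}

/-- `∂_a h_{bc} = C_{ab}^s h_{sc} + C_{ac}^s h_{bs}` at `x`. -/
def CompatibleAt (D : ι → (X → ℝ) → X → ℝ) (h : X → Matrix ι ι ℝ) (C : X → ι → ι → ι → ℝ)
    (x : X) : Prop :=
  ∀ a b c, D a (fun y => h y b c) x = ∑ s, C x a b s * h x s c + ∑ s, C x a c s * h x b s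

lemma inv_symm (hs : ∀ a b, h x a b = h x b a) (a b : ι) : (h x)⁻¹ a b = (h x)⁻¹ b a := by
  have h1 : (h x).transpose = h x := by ext i j; exact hs j i
  have h2 : ((h x)⁻¹).transpose = (h x)⁻¹ := by rw [Matrix.transpose_nonsing_inv, h1]
  exact congrFun (congrFun h2 b) a

lemma sum_inv_mul (h0 : IsUnit (h x).det) (a c : ι) :
    ∑ s, (h x)⁻¹ a s * h x s c = if a = c then 1 else 0 := by
  rw [← Matrix.mul_apply, Matrix.nonsing_inv_mul _ h0, Matrix.one_apply]

lemma sum_mul_inv (h0 : IsUnit (h x).det) (a c : ι) :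
    ∑ s, h x a s * (h x)⁻¹ s c = if a = c then 1 else 0 := by
  rw [← Matrix.mul_apply, Matrix.mul_nonsing_inv _ h0, Matrix.one_apply]

lemma sum_inv_lower (h0 : IsUnit (h x).det) (f : ι → ℝ) (c : ι) :
    ∑ s, (h x)⁻¹ c s * ∑ t, h x s t * f t = f c := by
  have h1 : (h x)⁻¹.mulVec ((h x).mulVec f) = f := by
    rw [Matrix.mulVec_mulVec, Matrix.nonsing_inv_mul _ h0, Matrix.one_mulVec]
  exact congrFun h1 c

lemma sum_lower_inv (h0 : IsUnit (h x).det) (f : ι → ℝ) (c : ι) :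
    ∑ s, h x c s * ∑ t, (h x)⁻¹ s t * f t = f c := by
  have h1 : (h x).mulVec ((h x)⁻¹.mulVec f) = f := by
    rw [Matrix.mulVec_mulVec, Matrix.mul_nonsing_inv _ h0, Matrix.one_mulVec]
  exact congrFun h1 c

omit [DecidableEq ι] in
lemma lowerTorsion_antisymm (hS : ∀ a b c, S x a b c = -S x b a c) (a b c : ι) :
    lowerTorsion h S x a b c = -lowerTorsion h S x b a c := by
  simp only [lowerTorsion, ← Finset.sum_neg_distrib]
  exact Finset.sum_congr rfl fun s _ => by rw [hS a b s]; ring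

/-- With the upper index lowered, the Levi-Civita part symmetrised in its last two indices is `∂_a
h_{bc}`, while the contorsion is antisymmetric in them because `S` is antisymmetric in its first
two. Symmetry of `h` is needed at all points since it is used under the derivative. -/
lemma compatibleAt_connection (h0 : IsUnit (h x).det) (hs : ∀ y a b, h y a b = h y b a)
    (hS : ∀ a b c, S x a b c = -S x b a c) : CompatibleAt D h (connection D h S) x := by
  intro a b c
  have e1 := lower_connection D h S x h0 a b c
  have e2 := lower_connection D h S x h0 a c b
  have t1 := lowerTorsion_antisymm (h := h) hS a b c
  have t2 := lowerTorsion_antisymm (h := h) hS a c b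
  have t3 := lowerTorsion_antisymm (h := h) hS b c a
  have f1 : (fun y => h y c b) = fun y => h y b c := funext fun y => hs y c b
  have r1 : ∑ s, connection D h S x a b s * h x s c = ∑ s, h x c s * connection D h S x a b s :=
    Finset.sum_congr rfl fun s _ => by rw [hs x s c, mul_comm]
  have r2 : ∑ s, connection D h S x a c s * h x b s = ∑ s, h x b s * connection D h S x a c s :=
    Finset.sum_congr rfl fun s _ => mul_comm _ _
  rw [r1, r2, e1, e2, f1]
  linarith

lemma christoffel_symm (hs : ∀ y a b, h y a b = h y b a) (a b c : ι) :
    christoffel D h x a b c = christoffel D h x b a c := by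
  simp only [christoffel]
  congr 1
  refine Finset.sum_congr rfl fun s _ => ?_
  have f : ∀ a b, (fun y => h y a b) = fun y => h y b a := fun a b => funext fun y => hs y a b
  rw [f s b, f a s, f a b]
  ring

/-- The Levi-Civita part is symmetric in `a, b`, and so are the last two contorsion terms taken
together; only `S_{ab}^c` survives, twice. In this normalisation the torsion of the connection is
therefore `2 S`. -/
lemma connection_torsion (hs : ∀ y a b, h y a b = h y b a)
    (hS : ∀ a b c, S x a b c = -S x b a c) (a b c : ι) :
    connection D h S x a b c - connection D h S x b a c = 2 * S x a b c := by
  have e : ∀ a b, ∑ s, (h x)⁻¹ c s * lowerTorsion h S x s a b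
      = -∑ s, (h x)⁻¹ c s * lowerTorsion h S x a s b := by
    intro a b
    rw [← Finset.sum_neg_distrib]
    exact Finset.sum_congr rfl fun s _ => by rw [lowerTorsion_antisymm hS s a b]; ring
  simp only [connection, contorsion, christoffel_symm hs b a c, e, hS b a c]
  ring

lemma contorsion_eq (a b c : ι) :
    contorsion h S x a b c = connection D h S x a b c - christoffel D h x a b c := by
  simp [connection]

end Compatible

/-! ### Curvature of metric compatible connections and the Ricci identity -/

section CompatibleCalculus

variable {ι E : Type*} [Fintype ι] [DecidableEq ι] [NormedAddCommGroup E] [NormedSpace ℝ E]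
  {v : ι → E} {U : Set E} {h : E → Matrix ι ι ℝ} {C : E → ι → ι → ι → ℝ} {x : E}

/-- Antisymmetry of the curvature in its last index pair, in matrix form. With `M a = C_a`,
compatibility reads `∂_a h = M_a h + h M_aᵀ`. Differentiating once more and antisymmetrising, the
left side vanishes by symmetry of second derivatives, the mixed terms `M_a h M_bᵀ` cancel, and what
remains is the curvature acting on both indices of `h`. Torsion plays no role. -/
lemma riemann_mul_metric (hU : IsOpen U) (hx : x ∈ U)
    (hC : ∀ y ∈ U, CompatibleAt (dirDeriv v) h C y)
    (sh : ∀ a b, SmoothOn U fun y => h y a b) (sC : ∀ a b c, SmoothOn U fun y => C y a b c)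
    (a b : ι) :
    Matrix.of (riemann (dirDeriv v) C x a b) * h x
      + h x * (Matrix.of (riemann (dirDeriv v) C x a b)).transpose = 0 := by
  set M : ι → Matrix ι ι ℝ := fun a => Matrix.of (C x a) with hM
  set Q : ι → ι → Matrix ι ι ℝ :=
    fun b a => Matrix.of fun c e => dirDeriv v b (fun y => C y a c e) x with hQ
  have dh := fun a b => (sh a b).differentiableAt hU hx
  have dC := fun a b c => (sC a b c).differentiableAt hU hx
  have hR : Matrix.of (riemann (dirDeriv v) C x a b) = Q b a - Q a b + M a * M b - M b * M a := by
    ext c e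
    simp only [riemann, hQ, hM, Matrix.of_apply, Matrix.sub_apply, Matrix.add_apply,
      Matrix.mul_apply, Finset.sum_sub_distrib, mul_comm (C x _ _ e)]
    ring
  have d1 : ∀ a, Matrix.of (fun b c => dirDeriv v a (fun y => h y b c) x)
      = M a * h x + h x * (M a).transpose := by
    intro a
    ext b c
    simp only [Matrix.of_apply, hC x hx a b c, Matrix.add_apply, Matrix.mul_apply, hM,
      Matrix.transpose_apply, mul_comm (h x b _)]
  have d2 : ∀ b a, Matrix.of (fun c f => dirDeriv v b (dirDeriv v a fun y => h y c f) x)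
      = Q b a * h x + M a * (M b * h x + h x * (M b).transpose)
        + ((M b * h x + h x * (M b).transpose) * (M a).transpose + h x * (Q b a).transpose) := by
    intro b a
    rw [← d1 b]
    ext c f
    have e : dirDeriv v b (dirDeriv v a fun y => h y c f) x
        = dirDeriv v b (fun y => ∑ s, C y a c s * h y s f + ∑ s, h y c s * C y a f s) x :=
      dirDeriv_congr v b hU hx fun y hy => by
        rw [hC y hy a c f]
        simp only [mul_comm (h y c _)]
    rw [Matrix.of_apply, e, dirDeriv_add, dirDeriv_sum_mul, dirDeriv_sum_mul]
    · simp only [Matrix.add_apply, Matrix.mul_apply, hQ, hM, Matrix.of_apply,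
        Matrix.transpose_apply]
    all_goals first | exact fun _ => dh _ _ | exact fun _ => dC _ _ _ | skip
    · exact DifferentiableAt.fun_sum fun s _ => (dC _ _ _).mul (dh _ _)
    · exact DifferentiableAt.fun_sum fun s _ => (dh _ _).mul (dC _ _ _)
  have d3 : Matrix.of (fun c f => dirDeriv v b (dirDeriv v a fun y => h y c f) x)
      = Matrix.of (fun c f => dirDeriv v a (dirDeriv v b fun y => h y c f) x) := by
    ext c f
    exact dirDeriv_comm v b hU hx (sh c f) a
  rw [d2, d2, ← sub_eq_zero] at d3
  rw [hR, ← d3]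
  simp only [Matrix.transpose_sub, Matrix.transpose_add, Matrix.transpose_mul]
  noncomm_ring

/-- `R_{abc}^c = 0`. -/
lemma sum_riemann_diag (hU : IsOpen U) (hx : x ∈ U)
    (hC : ∀ y ∈ U, CompatibleAt (dirDeriv v) h C y) (h0 : IsUnit (h x).det)
    (sh : ∀ a b, SmoothOn U fun y => h y a b) (sC : ∀ a b c, SmoothOn U fun y => C y a b c)
    (a b : ι) : ∑ c, riemann (dirDeriv v) C x a b c c = 0 := by
  have e := riemann_mul_metric hU hx hC sh sC a b
  set R : Matrix ι ι ℝ := Matrix.of (riemann (dirDeriv v) C x a b) with hR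
  -- Conjugation by `h` does not change the trace, so taking traces gives `2 tr R = 0`.
  have e1 : R + h x * R.transpose * (h x)⁻¹ = 0 := by
    have := congrArg (· * (h x)⁻¹) e
    simpa [add_mul, Matrix.mul_assoc, Matrix.mul_nonsing_inv _ h0] using this
  have e2 := congrArg Matrix.trace e1
  rw [Matrix.trace_add, Matrix.mul_assoc, Matrix.trace_mul_comm, Matrix.mul_assoc,
    Matrix.nonsing_inv_mul _ h0, Matrix.mul_one, Matrix.trace_transpose, Matrix.trace_zero] at e2
  have e3 : R.trace = ∑ c, riemann (dirDeriv v) C x a b c c := rfl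
  linarith

/-- `h^{ac} R_{bca}^s = -R_{bj} h^{js}`. -/
lemma sum_inv_mul_riemann (hU : IsOpen U) (hx : x ∈ U)
    (hC : ∀ y ∈ U, CompatibleAt (dirDeriv v) h C y) (h0 : IsUnit (h x).det)
    (sh : ∀ a b, SmoothOn U fun y => h y a b) (sC : ∀ a b c, SmoothOn U fun y => C y a b c)
    (b s : ι) :
    ∑ c, ∑ a, (h x)⁻¹ c a * riemann (dirDeriv v) C x b c a s
      = -∑ j, ricci (dirDeriv v) C x b j * (h x)⁻¹ j s := by
  have key : ∀ c, ∑ a, (h x)⁻¹ c a * riemann (dirDeriv v) C x b c a s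
      = -∑ j, riemann (dirDeriv v) C x b c j c * (h x)⁻¹ j s := by
    intro c
    have e := riemann_mul_metric hU hx hC sh sC b c
    set R : Matrix ι ι ℝ := Matrix.of (riemann (dirDeriv v) C x b c) with hR
    have e1 : (h x)⁻¹ * R = -(R.transpose * (h x)⁻¹) := by
      have := congrArg (fun Z => (h x)⁻¹ * Z * (h x)⁻¹) e
      simp only [mul_add, add_mul, Matrix.mul_assoc, Matrix.mul_nonsing_inv _ h0, mul_zero,
        zero_mul, mul_one] at this
      rw [← Matrix.mul_assoc (h x)⁻¹ (h x), Matrix.nonsing_inv_mul _ h0, one_mul] at this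
      exact eq_neg_of_add_eq_zero_left this
    have e2 := congrFun (congrFun e1 c) s
    simpa only [Matrix.mul_apply, Matrix.neg_apply, Matrix.transpose_apply, hR,
      Matrix.of_apply] using e2
  simp only [key, ricci, Finset.sum_neg_distrib, Finset.sum_mul]
  rw [Finset.sum_comm]

/-- `∂_b h^{ac} = -C_{bs}^a h^{sc} - C_{bs}^c h^{as}`. -/
lemma dirDeriv_inv (hU : IsOpen U) (hx : x ∈ U)
    (hC : CompatibleAt (dirDeriv v) h C x) (h0 : ∀ y ∈ U, IsUnit (h y).det)
    (sh : ∀ a b, SmoothOn U fun y => h y a b) (b a c : ι) :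
    dirDeriv v b (fun y => (h y)⁻¹ a c) x
      = -∑ s, C x b s a * (h x)⁻¹ s c - ∑ s, (h x)⁻¹ a s * C x b s c := by
  have dh := fun a b => (sh a b).differentiableAt hU hx
  have dhi := fun a b => (SmoothOn.matrix_inv sh h0 a b).differentiableAt hU hx
  set M : Matrix ι ι ℝ := Matrix.of (C x b) with hM
  set dH : Matrix ι ι ℝ := Matrix.of fun a c => dirDeriv v b (fun y => h y a c) x with hdH
  set dI : Matrix ι ι ℝ := Matrix.of fun a c => dirDeriv v b (fun y => (h y)⁻¹ a c) x with hdI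
  have e1 : dH = M * h x + h x * M.transpose := by
    ext a c
    simp only [hdH, Matrix.of_apply, hC b a c, Matrix.add_apply, Matrix.mul_apply, hM,
      Matrix.transpose_apply, mul_comm (h x a _)]
  have e2 : dH * (h x)⁻¹ + h x * dI = 0 := by
    ext a c
    have : dirDeriv v b (fun y => ∑ s, h y a s * (h y)⁻¹ s c) x
        = dirDeriv v b (fun _ => if a = c then 1 else 0) x :=
      dirDeriv_congr v b hU hx fun y hy => sum_mul_inv (h0 y hy) a c
    rw [dirDeriv_const, dirDeriv_sum_mul v b (fun _ => dh _ _) (fun _ => dhi _ _)] at this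
    simpa only [Matrix.add_apply, Matrix.mul_apply, hdH, hdI, Matrix.of_apply,
      Matrix.zero_apply] using this
  have e3 : dI = -(M.transpose * (h x)⁻¹) - (h x)⁻¹ * M := by
    have := congrArg ((h x)⁻¹ * ·) e2
    simp only [e1, mul_add, add_mul, ← Matrix.mul_assoc, Matrix.nonsing_inv_mul _ (h0 x hx),
      one_mul, mul_zero] at this
    rw [Matrix.mul_assoc _ (h x), Matrix.mul_nonsing_inv _ (h0 x hx), mul_one] at this
    rw [← sub_eq_zero, ← this]
    abel
  have := congrFun (congrFun e3 a) c
  simpa only [hdI, Matrix.of_apply, Matrix.sub_apply, Matrix.neg_apply, Matrix.mul_apply,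
    Matrix.transpose_apply, hM] using this

/-- `∂_b (h^{ac} ψ_{ca}) = h^{ac} ∇_b ψ_{ca}`. -/
lemma dirDeriv_trace (hU : IsOpen U) (hx : x ∈ U)
    (hC : CompatibleAt (dirDeriv v) h C x) (h0 : ∀ y ∈ U, IsUnit (h y).det)
    (sh : ∀ a b, SmoothOn U fun y => h y a b) {ψ : E → ι → ι → ℝ}
    (sψ : ∀ a b, SmoothOn U fun y => ψ y a b) (b : ι) :
    dirDeriv v b (fun y => ∑ a, ∑ c, (h y)⁻¹ a c * ψ y c a) x
      = ∑ a, ∑ c, (h x)⁻¹ a c * cov2 (dirDeriv v) C ψ x b c a := by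
  have dψ := fun a b => (sψ a b).differentiableAt hU hx
  have dhi := fun a b => (SmoothOn.matrix_inv sh h0 a b).differentiableAt hU hx
  rw [dirDeriv_sum v b (F := fun a y => ∑ c, (h y)⁻¹ a c * ψ y c a) fun a =>
    DifferentiableAt.fun_sum fun c _ => (dhi a c).mul (dψ c a)]
  simp only [dirDeriv_sum_mul v b (fun c => dhi _ c) (fun c => dψ c _),
    dirDeriv_inv hU hx hC h0 sh, cov2, mul_sub, sub_mul, neg_mul, Finset.sum_add_distrib,
    Finset.sum_sub_distrib, Finset.sum_neg_distrib, Finset.sum_mul, Finset.mul_sum]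
  have r1 : ∑ a, ∑ c, ∑ s, C x b s a * (h x)⁻¹ s c * ψ x c a
      = ∑ a, ∑ c, ∑ e, (h x)⁻¹ a c * (C x b a e * ψ x c e) := by
    rw [Finset.sum_comm, Finset.sum_congr rfl fun c _ => Finset.sum_comm, Finset.sum_comm]
    exact Finset.sum_congr rfl fun _ _ => Finset.sum_congr rfl fun _ _ =>
      Finset.sum_congr rfl fun _ _ => by ring
  have r2 : ∑ a, ∑ c, ∑ s, (h x)⁻¹ a s * C x b s c * ψ x c a
      = ∑ a, ∑ c, ∑ e, (h x)⁻¹ a c * (C x b c e * ψ x e a) := by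
    refine Finset.sum_congr rfl fun a _ => ?_
    rw [Finset.sum_comm]
    exact Finset.sum_congr rfl fun _ _ => Finset.sum_congr rfl fun _ _ => by ring
  rw [r1, r2]
  ring

omit [DecidableEq ι] in
/-- Ricci identity for 1-forms. -/
lemma cov2_cov1_sub (hU : IsOpen U) (hx : x ∈ U)
    (sC : ∀ a b c, SmoothOn U fun y => C y a b c) {σ : E → ι → ℝ}
    (sσ : ∀ a, SmoothOn U fun y => σ y a) (c b a : ι) :
    cov2 (dirDeriv v) C (cov1 (dirDeriv v) C σ) x c b a
        - cov2 (dirDeriv v) C (cov1 (dirDeriv v) C σ) x b c a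
      = -∑ s, riemann (dirDeriv v) C x b c a s * σ x s
        - ∑ s, (C x c b s - C x b c s) * cov1 (dirDeriv v) C σ x s a := by
  have dC := fun a b c => (sC a b c).differentiableAt hU hx
  have dσ := fun a => (sσ a).differentiableAt hU hx
  have e : ∀ c b, dirDeriv v c (fun y => cov1 (dirDeriv v) C σ y b a) x
      = dirDeriv v c (dirDeriv v b fun y => σ y a) x
        - (∑ s, dirDeriv v c (fun y => C y b a s) x * σ x s
          + ∑ s, C x b a s * dirDeriv v c (fun y => σ y s) x) := by
    intro c b
    rw [← dirDeriv_sum_mul v c (fun _ => dC _ _ _) (fun _ => dσ _)]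
    exact dirDeriv_sub v c (((sσ a).dirDeriv hU v b).differentiableAt hU hx)
      (DifferentiableAt.fun_sum fun s _ => (dC _ _ _).mul (dσ _))
  have q : ∀ c b, ∑ e, C x c a e * cov1 (dirDeriv v) C σ x b e
      = ∑ e, C x c a e * dirDeriv v b (fun y => σ y e) x
        - ∑ s, ∑ e, C x b e s * C x c a e * σ x s := by
    intro c b
    simp only [cov1, mul_sub, Finset.sum_sub_distrib, Finset.mul_sum]
    rw [Finset.sum_comm (f := fun e s => C x c a e * (C x b e s * σ x s))]
    congr 1
    exact Finset.sum_congr rfl fun _ _ => Finset.sum_congr rfl fun _ _ => by ring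
  have r : ∑ s, riemann (dirDeriv v) C x b c a s * σ x s
      = ∑ s, dirDeriv v c (fun y => C y b a s) x * σ x s
        - ∑ s, dirDeriv v b (fun y => C y c a s) x * σ x s
        + (∑ s, ∑ e, C x c e s * C x b a e * σ x s - ∑ s, ∑ e, C x b e s * C x c a e * σ x s) := by
    simp only [riemann, add_mul, sub_mul, Finset.sum_add_distrib, Finset.sum_sub_distrib,
      Finset.sum_mul]
  rw [cov2, cov2, e, e, q, q, r, dirDeriv_comm v c hU hx (sσ a) b]
  simp only [sub_mul, Finset.sum_sub_distrib]
  ring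

/-- `∇^a ∇_b σ_a = ∇_b ∇^a σ_a + R_{bj} σ^j - T_{ab}^s ∇_s σ^a`, `T` the torsion of `C`. -/
lemma div2_transpose_cov1 (hU : IsOpen U) (hx : x ∈ U)
    (hC : ∀ y ∈ U, CompatibleAt (dirDeriv v) h C y) (h0 : ∀ y ∈ U, IsUnit (h y).det)
    (hs : ∀ a b, h x a b = h x b a)
    (sh : ∀ a b, SmoothOn U fun y => h y a b) (sC : ∀ a b c, SmoothOn U fun y => C y a b c)
    {σ : E → ι → ℝ} (sσ : ∀ a, SmoothOn U fun y => σ y a)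
    (scov : ∀ a b, SmoothOn U fun y => cov1 (dirDeriv v) C σ y a b) (b : ι) :
    div2 (dirDeriv v) h C (fun y a b => cov1 (dirDeriv v) C σ y b a) x b
      = dirDeriv v b (div1 (dirDeriv v) h C σ) x
        + ∑ j, ricci (dirDeriv v) C x b j * raise1 h σ x j
        - ∑ a, ∑ c, (h x)⁻¹ a c
            * ∑ s, (C x c b s - C x b c s) * cov1 (dirDeriv v) C σ x s a := by
  have t : div2 (dirDeriv v) h C (fun y a b => cov1 (dirDeriv v) C σ y b a) x b
      = ∑ a, ∑ c, (h x)⁻¹ a c * cov2 (dirDeriv v) C (cov1 (dirDeriv v) C σ) x c b a := by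
    refine Finset.sum_congr rfl fun a _ => Finset.sum_congr rfl fun c _ => ?_
    simp only [cov2]
    ring
  -- The Ricci identity contracts the curvature on its lower index `a`, whereas the Ricci tensor
  -- contracts the upper one; metric antisymmetry exchanges the two at the cost of a sign.
  have r : ∑ a, ∑ c, (h x)⁻¹ a c * ∑ s, riemann (dirDeriv v) C x b c a s * σ x s
      = -∑ j, ricci (dirDeriv v) C x b j * raise1 h σ x j := by
    have := fun s => sum_inv_mul_riemann hU hx hC (h0 x hx) sh sC b s
    calc _ = ∑ s, (∑ c, ∑ a, (h x)⁻¹ c a * riemann (dirDeriv v) C x b c a s) * σ x s := by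
          simp only [Finset.mul_sum, Finset.sum_mul]
          rw [Finset.sum_comm, Finset.sum_congr rfl fun c _ => Finset.sum_comm, Finset.sum_comm]
          refine Finset.sum_congr rfl fun _ _ => Finset.sum_congr rfl fun c _ =>
            Finset.sum_congr rfl fun a _ => ?_
          rw [inv_symm hs a c]
          ring
      _ = _ := by
          simp only [this, raise1, Finset.mul_sum, Finset.sum_mul, neg_mul,
            Finset.sum_neg_distrib]
          rw [Finset.sum_comm]
          simp only [mul_assoc]
  have g : dirDeriv v b (div1 (dirDeriv v) h C σ) x
      = ∑ a, ∑ c, (h x)⁻¹ a c * cov2 (dirDeriv v) C (cov1 (dirDeriv v) C σ) x b c a :=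
    dirDeriv_trace hU hx (hC x hx) h0 sh scov b
  have k : ∑ a, ∑ c, (h x)⁻¹ a c * cov2 (dirDeriv v) C (cov1 (dirDeriv v) C σ) x c b a
      = ∑ a, ∑ c, (h x)⁻¹ a c * cov2 (dirDeriv v) C (cov1 (dirDeriv v) C σ) x b c a
        - ∑ a, ∑ c, (h x)⁻¹ a c * ∑ s, riemann (dirDeriv v) C x b c a s * σ x s
        - ∑ a, ∑ c, (h x)⁻¹ a c
            * ∑ s, (C x c b s - C x b c s) * cov1 (dirDeriv v) C σ x s a := by
    simp only [← Finset.sum_sub_distrib, ← mul_sub]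
    refine Finset.sum_congr rfl fun a _ => Finset.sum_congr rfl fun c _ => ?_
    have := cov2_cov1_sub (v := v) hU hx sC sσ c b a
    simp only [Finset.sum_sub_distrib, sub_mul] at this ⊢
    congr 1
    linarith
  rw [t, k, r, g]
  ring

end CompatibleCalculus

/-! ### Identities for metric compatible connections with torsion -/

section TorsionIdentities

variable {ι E : Type*} [Fintype ι] [DecidableEq ι] [NormedAddCommGroup E] [NormedSpace ℝ E]
  {v : ι → E} {U : Set E} {h : E → Matrix ι ι ℝ} {S C : E → ι → ι → ι → ℝ} {x : E}

lemma smoothOn_christoffel (hU : IsOpen U) (h0 : ∀ y ∈ U, IsUnit (h y).det)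
    (sh : ∀ a b, SmoothOn U fun y => h y a b) (a b c : ι) :
    SmoothOn U fun y => christoffel (dirDeriv v) h y a b c :=
  (SmoothOn.const _).mul <| .sum fun s => (SmoothOn.matrix_inv sh h0 c s).mul <|
    (((sh s b).dirDeriv hU v a).add ((sh a s).dirDeriv hU v b)).sub ((sh a b).dirDeriv hU v s)

omit [DecidableEq ι] in
lemma smoothOn_lowerTorsion (sh : ∀ a b, SmoothOn U fun y => h y a b)
    (sS : ∀ a b c, SmoothOn U fun y => S y a b c) (a b c : ι) :
    SmoothOn U fun y => lowerTorsion h S y a b c :=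
  .sum fun s => (sh c s).mul (sS a b s)

lemma smoothOn_contorsion (h0 : ∀ y ∈ U, IsUnit (h y).det)
    (sh : ∀ a b, SmoothOn U fun y => h y a b) (sS : ∀ a b c, SmoothOn U fun y => S y a b c)
    (a b c : ι) : SmoothOn U fun y => contorsion h S y a b c :=
  ((sS a b c).add <| .sum fun s =>
    (SmoothOn.matrix_inv sh h0 c s).mul (smoothOn_lowerTorsion sh sS s a b)).sub <| .sum fun s =>
    (SmoothOn.matrix_inv sh h0 c s).mul (smoothOn_lowerTorsion sh sS b s a)

lemma smoothOn_connection (hU : IsOpen U) (h0 : ∀ y ∈ U, IsUnit (h y).det)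
    (sh : ∀ a b, SmoothOn U fun y => h y a b) (sS : ∀ a b c, SmoothOn U fun y => S y a b c)
    (a b c : ι) : SmoothOn U fun y => connection (dirDeriv v) h S y a b c :=
  (smoothOn_christoffel hU h0 sh a b c).add (smoothOn_contorsion h0 sh sS a b c)

omit [DecidableEq ι] in
lemma smoothOn_cov1 (hU : IsOpen U) (sC : ∀ a b c, SmoothOn U fun y => C y a b c)
    {σ : E → ι → ℝ} (sσ : ∀ a, SmoothOn U fun y => σ y a) (a b : ι) :
    SmoothOn U fun y => cov1 (dirDeriv v) C σ y a b :=
  ((sσ b).dirDeriv hU v a).sub <| .sum fun c => (sC a b c).mul (sσ c)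

omit [DecidableEq ι] in
lemma smoothOn_cov3 (hU : IsOpen U) (sC : ∀ a b c, SmoothOn U fun y => C y a b c)
    {ψ : E → ι → ι → ι → ℝ} (sψ : ∀ a b c, SmoothOn U fun y => ψ y a b c) (a b c e : ι) :
    SmoothOn U fun y => cov3 (dirDeriv v) C ψ y a b c e :=
  (((((sψ b c e).dirDeriv hU v a).sub <| .sum fun f => (sC a b f).mul (sψ f c e)).sub <|
    .sum fun f => (sC a c f).mul (sψ b f e)).sub <| .sum fun f => (sC a e f).mul (sψ b c f))

lemma div2_congr (hU : IsOpen U) (hx : x ∈ U) {ψ χ : E → ι → ι → ℝ}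
    (e : ∀ y ∈ U, ∀ a b, ψ y a b = χ y a b) (b : ι) :
    div2 (dirDeriv v) h C ψ x b = div2 (dirDeriv v) h C χ x b := by
  simp only [div2, cov2, e x hx, fun a b c => dirDeriv_congr v c hU hx fun y hy => e y hy a b]

lemma div2_add {ψ χ : E → ι → ι → ℝ} (dψ : ∀ a b, DifferentiableAt ℝ (fun y => ψ y a b) x)
    (dχ : ∀ a b, DifferentiableAt ℝ (fun y => χ y a b) x) (b : ι) :
    div2 (dirDeriv v) h C (fun y a b => ψ y a b + χ y a b) x b
      = div2 (dirDeriv v) h C ψ x b + div2 (dirDeriv v) h C χ x b := by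
  simp only [div2, cov2, fun a b c => dirDeriv_add v c (dψ a b) (dχ a b),
    ← Finset.sum_add_distrib]
  refine Finset.sum_congr rfl fun a _ => Finset.sum_congr rfl fun c _ => ?_
  simp only [mul_add, Finset.sum_add_distrib]
  ring

lemma div2_const_mul {ψ : E → ι → ι → ℝ} (k : ℝ)
    (dψ : ∀ a b, DifferentiableAt ℝ (fun y => ψ y a b) x) (b : ι) :
    div2 (dirDeriv v) h C (fun y a b => k * ψ y a b) x b
      = k * div2 (dirDeriv v) h C ψ x b := by
  simp only [div2, cov2, fun a b c => dirDeriv_const_mul v c k (dψ a b), Finset.mul_sum]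
  refine Finset.sum_congr rfl fun a _ => Finset.sum_congr rfl fun c _ => ?_
  simp only [mul_sub, Finset.mul_sum, mul_left_comm]

/-- The divergence `∇_i S_{ab}^i`. -/
def divTorsion (D : ι → (E → ℝ) → E → ℝ) (C S : E → ι → ι → ι → ℝ) (x : E) (a b : ι) : ℝ :=
  ∑ i, D i (fun y => S y a b i) x - ∑ i, ∑ s, C x i a s * S x s b i
    - ∑ i, ∑ s, C x i b s * S x a s i + ∑ i, ∑ s, C x i s i * S x a b s

/-- Since the covariant derivative of `h` vanishes, lowering the last index commutes with it. The
divergence may thus be computed with `S_{ab}^i`, whose coordinate expression contains no derivative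
of `h` beyond those in `C`. -/
lemma sum_inv_cov3_lowerTorsion (hC : CompatibleAt (dirDeriv v) h C x)
    (h0 : IsUnit (h x).det)
    (dh : ∀ a b, DifferentiableAt ℝ (fun y => h y a b) x)
    (dS : ∀ a b c, DifferentiableAt ℝ (fun y => S y a b c) x) (a b : ι) :
    ∑ i, ∑ j, (h x)⁻¹ i j * cov3 (dirDeriv v) C (lowerTorsion h S) x i a b j
      = divTorsion (dirDeriv v) C S x a b := by
  have key : ∀ i j, cov3 (dirDeriv v) C (lowerTorsion h S) x i a b j
      = ∑ s, h x j s * (dirDeriv v i (fun y => S y a b s) x - ∑ f, C x i a f * S x f b s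
          - ∑ f, C x i b f * S x a f s + ∑ f, C x i f s * S x a b f) := by
    intro i j
    have e : dirDeriv v i (fun y => lowerTorsion h S y a b j) x
        = ∑ s, (∑ f, C x i j f * h x f s + ∑ f, C x i s f * h x j f) * S x a b s
          + ∑ s, h x j s * dirDeriv v i (fun y => S y a b s) x := by
      simp only [← hC i j]
      exact dirDeriv_sum_mul v i (fun _ => dh _ _) (fun _ => dS _ _ _)
    rw [cov3, e]
    simp only [lowerTorsion, mul_add, mul_sub, add_mul, Finset.sum_add_distrib,
      Finset.sum_sub_distrib, Finset.mul_sum, Finset.sum_mul]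
    have r1 : ∑ s, ∑ f, C x i j f * h x f s * S x a b s
        = ∑ f, ∑ s, C x i j f * (h x f s * S x a b s) := by
      rw [Finset.sum_comm]; simp only [mul_assoc]
    have r2 : ∑ s, ∑ f, C x i s f * h x j f * S x a b s
        = ∑ s, ∑ f, h x j s * (C x i f s * S x a b f) := by
      rw [Finset.sum_comm]
      exact Finset.sum_congr rfl fun _ _ => Finset.sum_congr rfl fun _ _ => by ring
    have r3 : ∀ (A B : ι → ι → ℝ), ∑ f, ∑ s, A f f * (h x j s * B f s)
        = ∑ s, ∑ f, h x j s * (A f f * B f s) := by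
      intro A B
      rw [Finset.sum_comm]
      exact Finset.sum_congr rfl fun _ _ => Finset.sum_congr rfl fun _ _ => by ring
    rw [r1, r2, r3 (fun f _ => C x i a f) (fun f s => S x f b s),
      r3 (fun f _ => C x i b f) (fun f s => S x a f s)]
    ring
  simp only [key, sum_inv_lower h0, divTorsion, Finset.sum_add_distrib, Finset.sum_sub_distrib]

omit [DecidableEq ι] in
/-- `∇_i (h_{ca} σ_b) = h_{ca} ∇_i σ_b`. -/
lemma cov3_metric_mul (hC : CompatibleAt (dirDeriv v) h C x) {σ : E → ι → ℝ}
    (dh : ∀ a b, DifferentiableAt ℝ (fun y => h y a b) x)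
    (dσ : ∀ a, DifferentiableAt ℝ (fun y => σ y a) x) (i a b c : ι) :
    cov3 (dirDeriv v) C (fun y a b c => h y c a * σ y b) x i a b c
        = h x c a * cov1 (dirDeriv v) C σ x i b := by
  rw [cov3, dirDeriv_mul v i (dh c a) (dσ b), hC i c a, cov1]
  simp only [add_mul, mul_sub, Finset.mul_sum, Finset.sum_mul]
  simp only [mul_assoc, mul_left_comm (h x c a)]
  ring

omit [DecidableEq ι] in
lemma cov3_metric_mul' (hC : CompatibleAt (dirDeriv v) h C x) {σ : E → ι → ℝ}
    (dh : ∀ a b, DifferentiableAt ℝ (fun y => h y a b) x)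
    (dσ : ∀ a, DifferentiableAt ℝ (fun y => σ y a) x) (i a b c : ι) :
    cov3 (dirDeriv v) C (fun y a b c => h y c b * σ y a) x i a b c
        = h x c b * cov1 (dirDeriv v) C σ x i a := by
  rw [← cov3_metric_mul hC dh dσ i b a c, cov3, cov3]
  ring

/-- `∇_i S̄_{ab}^i = ∇_i S_{ab}^i + k (∇_a σ_b - ∇_b σ_a)` for
`S̄_{abc} = S_{abc} + k (h_{ca} σ_b - h_{cb} σ_a)`. -/
lemma sum_inv_cov3_traceless (hC : CompatibleAt (dirDeriv v) h C x)
    (h0 : IsUnit (h x).det) {σ : E → ι → ℝ}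
    (dh : ∀ a b, DifferentiableAt ℝ (fun y => h y a b) x)
    (dS : ∀ a b c, DifferentiableAt ℝ (fun y => S y a b c) x)
    (dσ : ∀ a, DifferentiableAt ℝ (fun y => σ y a) x) (k : ℝ) (a b : ι) :
    ∑ i, ∑ j, (h x)⁻¹ i j * cov3 (dirDeriv v) C (fun y a b c => lowerTorsion h S y a b c
        + k * (h y c a * σ y b - h y c b * σ y a)) x i a b j
      = divTorsion (dirDeriv v) C S x a b
        + k * (cov1 (dirDeriv v) C σ x a b - cov1 (dirDeriv v) C σ x b a) := by
  have key : ∀ i j, cov3 (dirDeriv v) C (fun y a b c => lowerTorsion h S y a b c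
        + k * (h y c a * σ y b - h y c b * σ y a)) x i a b j
      = cov3 (dirDeriv v) C (lowerTorsion h S) x i a b j
        + k * (h x j a * cov1 (dirDeriv v) C σ x i b - h x j b * cov1 (dirDeriv v) C σ x i a) := by
    intro i j
    have dl : DifferentiableAt ℝ (fun y => lowerTorsion h S y a b j) x :=
      DifferentiableAt.fun_sum fun s _ => (dh _ _).mul (dS _ _ _)
    rw [← cov3_metric_mul hC dh dσ i a b j, ← cov3_metric_mul' hC dh dσ i a b j]
    simp only [cov3]
    rw [dirDeriv_add v i dl ((((dh _ _).fun_mul (dσ _)).fun_sub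
      ((dh _ _).fun_mul (dσ _))).const_mul k),
      dirDeriv_const_mul v i k (((dh _ _).fun_mul (dσ _)).fun_sub ((dh _ _).fun_mul (dσ _))),
      dirDeriv_sub v i ((dh _ _).fun_mul (dσ _)) ((dh _ _).fun_mul (dσ _))]
    have r : ∀ (c X Y Z : ι → ℝ), ∑ f, c f * (X f + k * (Y f - Z f))
        = ∑ f, c f * X f + k * (∑ f, c f * Y f - ∑ f, c f * Z f) := by
      intro c X Y Z
      rw [← Finset.sum_sub_distrib, Finset.mul_sum, ← Finset.sum_add_distrib]
      exact Finset.sum_congr rfl fun _ _ => by ring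
    rw [r, r, r]
    ring
  have δ : ∀ (a : ι) (f : ι → ℝ), ∑ i, ∑ j, (h x)⁻¹ i j * (h x j a * f i) = f a := by
    intro a f
    simp only [← mul_assoc, ← Finset.sum_mul, sum_inv_mul h0]
    simp
  have e : ∀ i j, (h x)⁻¹ i j * cov3 (dirDeriv v) C (fun y a b c => lowerTorsion h S y a b c
        + k * (h y c a * σ y b - h y c b * σ y a)) x i a b j
      = (h x)⁻¹ i j * cov3 (dirDeriv v) C (lowerTorsion h S) x i a b j
        + k * ((h x)⁻¹ i j * (h x j a * cov1 (dirDeriv v) C σ x i b)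
          - (h x)⁻¹ i j * (h x j b * cov1 (dirDeriv v) C σ x i a)) := by
    intro i j
    rw [key]
    ring
  simp only [e, Finset.sum_add_distrib, ← Finset.mul_sum, Finset.sum_sub_distrib, δ,
    sum_inv_cov3_lowerTorsion hC h0 dh dS]

/-- Contracted first Bianchi identity:
`R_{ab} - R_{ba} = 2 (∇_i S_{ab}^i + ∇_a σ_b - ∇_b σ_a + 2 S_{ab}^j σ_j)`, `σ_a = S_{ai}^i`. -/
lemma ricci_antisymm (hU : IsOpen U) (hx : x ∈ U)
    (hC : ∀ y ∈ U, CompatibleAt (dirDeriv v) h C y) (h0 : IsUnit (h x).det)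
    (sh : ∀ a b, SmoothOn U fun y => h y a b) (sC : ∀ a b c, SmoothOn U fun y => C y a b c)
    (sS : ∀ a b c, SmoothOn U fun y => S y a b c)
    (hT : ∀ y ∈ U, ∀ a b c, C y a b c - C y b a c = 2 * S y a b c) (a b : ι) :
    ricci (dirDeriv v) C x a b - ricci (dirDeriv v) C x b a
      = 2 * (divTorsion (dirDeriv v) C S x a b
        + (cov1 (dirDeriv v) C (fun y a => ∑ i, S y a i i) x a b
          - cov1 (dirDeriv v) C (fun y a => ∑ i, S y a i i) x b a)
        + 2 * ∑ j, S x a b j * ∑ i, S x j i i) := by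
  have dC := fun a b c => (sC a b c).differentiableAt hU hx
  have dS := fun a b c => (sS a b c).differentiableAt hU hx
  -- The torsion is replaced by the antisymmetric part of `C`. Both sides then become expressions in
  -- `C` and `∂C`, to be matched contraction by contraction.
  have hdS : ∀ i a b c, dirDeriv v i (fun y => S y a b c) x
      = 1 / 2 * (dirDeriv v i (fun y => C y a b c) x - dirDeriv v i (fun y => C y b a c) x) := by
    intro i a b c
    rw [← dirDeriv_sub v i (dC _ _ _) (dC _ _ _), ← dirDeriv_const_mul v i _
      ((dC _ _ _).fun_sub (dC _ _ _))]
    exact dirDeriv_congr v i hU hx fun y hy => by rw [hT y hy]; ring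
  have hS : ∀ a b c, S x a b c = 1 / 2 * (C x a b c - C x b a c) := by
    intro a b c
    rw [hT x hx]; ring
  -- The cyclic identity leaves the trace `R_{abc}^c` besides `R_{ab} - R_{ba}`; metric
  -- compatibility enters only here, to remove it.
  have z := sum_riemann_diag hU hx hC h0 sh sC a b
  have zz : ∑ c, ∑ s, C x b s c * C x a c s = ∑ c, ∑ s, C x a s c * C x b c s := by
    rw [Finset.sum_comm]
    exact Finset.sum_congr rfl fun _ _ => Finset.sum_congr rfl fun _ _ => mul_comm _ _
  have V : ∑ c, ∑ s, C x c a s * C x s b c = ∑ c, ∑ s, C x c b s * C x s a c := by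
    rw [Finset.sum_comm]
    exact Finset.sum_congr rfl fun _ _ => Finset.sum_congr rfl fun _ _ => mul_comm _ _
  have Z : ∀ a b, ∑ c, ∑ s, C x a s c * C x c b s = ∑ c, ∑ s, C x c b s * C x a s c :=
    fun a b => Finset.sum_congr rfl fun _ _ => Finset.sum_congr rfl fun _ _ => mul_comm _ _
  have W : ∑ j, S x a b j * ∑ i, S x j i i
      = 1 / 2 * (∑ j, C x a b j * ∑ i, S x j i i - ∑ j, C x b a j * ∑ i, S x j i i) := by
    rw [← Finset.sum_sub_distrib, Finset.mul_sum]
    exact Finset.sum_congr rfl fun j _ => by rw [hS a b j]; ring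
  have M : divTorsion (dirDeriv v) C S x a b
      = 1 / 2 * (∑ i, dirDeriv v i (fun y => C y a b i) x - ∑ i, dirDeriv v i (fun y => C y b a i) x
        - (∑ i, ∑ s, C x i a s * C x s b i - ∑ i, ∑ s, C x i a s * C x b s i)
        - (∑ i, ∑ s, C x i b s * C x a s i - ∑ i, ∑ s, C x i b s * C x s a i)
        + (∑ i, ∑ s, C x i s i * C x a b s - ∑ i, ∑ s, C x i s i * C x b a s)) := by
    simp only [divTorsion, hdS, hS, ← Finset.sum_sub_distrib, ← Finset.sum_add_distrib,
      Finset.mul_sum]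
    refine Finset.sum_congr rfl fun i _ => ?_
    simp only [mul_sub, mul_add, Finset.mul_sum, Finset.sum_sub_distrib, mul_left_comm (1 / 2 : ℝ)]
  have σd : ∀ a b, cov1 (dirDeriv v) C (fun y a => ∑ i, S y a i i) x a b
      = 1 / 2 * (∑ c, dirDeriv v a (fun y => C y b c c) x - ∑ c, dirDeriv v a (fun y => C y c b c) x)
        - ∑ j, C x a b j * ∑ i, S x j i i := by
    intro a b
    rw [cov1, dirDeriv_sum v a fun i => dS b i i]
    simp only [hdS, ← Finset.mul_sum, ← Finset.sum_sub_distrib]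
  rw [σd, σd, W, M]
  simp only [ricci, riemann, Finset.sum_add_distrib, Finset.sum_sub_distrib] at z ⊢
  rw [Z a b, Z b a]
  linarith

omit [NormedAddCommGroup E] [NormedSpace ℝ E] in
/-- `h^{ac} 𝒦_{ca}^j = 2 S^{ji}_i`. -/
lemma sum_inv_contorsion (h0 : IsUnit (h x).det) (hs : ∀ a b, h x a b = h x b a)
    (hS : ∀ a b c, S x a b c = -S x b a c) (j : ι) :
    ∑ a, ∑ c, (h x)⁻¹ a c * contorsion h S x c a j
      = 2 * raise1 h (fun y a => ∑ i, S y a i i) x j := by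
  have e1 : ∑ a, ∑ c, (h x)⁻¹ a c * S x c a j = 0 := by
    have : ∑ a, ∑ c, (h x)⁻¹ a c * S x c a j = -∑ a, ∑ c, (h x)⁻¹ a c * S x c a j := by
      conv_lhs => rw [Finset.sum_comm]
      simp only [← Finset.sum_neg_distrib]
      refine Finset.sum_congr rfl fun a _ => Finset.sum_congr rfl fun c _ => ?_
      rw [hS a c j, inv_symm hs c a]
      ring
    linarith
  have e2 : ∀ s, ∑ a, ∑ c, (h x)⁻¹ a c * lowerTorsion h S x s c a = ∑ i, S x s i i := by
    intro s
    rw [Finset.sum_comm]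
    refine Finset.sum_congr rfl fun c _ => ?_
    rw [← sum_inv_lower h0 (S x s c) c]
    exact Finset.sum_congr rfl fun a _ => by rw [inv_symm hs a c, lowerTorsion]
  have e3 : ∀ s, ∑ a, ∑ c, (h x)⁻¹ a c * lowerTorsion h S x a s c = -∑ i, S x s i i := by
    intro s
    rw [← e2 s, Finset.sum_comm]
    simp only [← Finset.sum_neg_distrib]
    refine Finset.sum_congr rfl fun a _ => Finset.sum_congr rfl fun c _ => ?_
    rw [lowerTorsion_antisymm hS c s a, inv_symm hs c a]
    ring
  have sw : ∀ L : ι → ι → ι → ℝ, ∑ a, ∑ c, (h x)⁻¹ a c * ∑ s, (h x)⁻¹ j s * L s a c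
      = ∑ s, (h x)⁻¹ j s * ∑ a, ∑ c, (h x)⁻¹ a c * L s a c := by
    intro L
    simp only [Finset.mul_sum]
    rw [Finset.sum_congr rfl fun a _ => Finset.sum_comm, Finset.sum_comm]
    exact Finset.sum_congr rfl fun _ _ => Finset.sum_congr rfl fun _ _ =>
      Finset.sum_congr rfl fun _ _ => by ring
  simp only [contorsion, mul_add, mul_sub, Finset.sum_add_distrib, Finset.sum_sub_distrib, e1,
    sw fun s a c => lowerTorsion h S x s c a, sw fun s a c => lowerTorsion h S x a s c, e2, e3,
    raise1, mul_neg, Finset.sum_neg_distrib]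
  ring

/-- The Levi-Civita Laplacian of a 1-form in terms of the connection with torsion. -/
lemma div2_christoffel_cov1 (hU : IsOpen U) (hx : x ∈ U) (h0 : ∀ y ∈ U, IsUnit (h y).det)
    (hs : ∀ a b, h x a b = h x b a) (hS : ∀ a b c, S x a b c = -S x b a c)
    (sh : ∀ a b, SmoothOn U fun y => h y a b) (sS : ∀ a b c, SmoothOn U fun y => S y a b c)
    {σ : E → ι → ℝ} (sσ : ∀ a, SmoothOn U fun y => σ y a) (b : ι) :
    div2 (dirDeriv v) h (christoffel (dirDeriv v) h)
        (cov1 (dirDeriv v) (christoffel (dirDeriv v) h) σ) x b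
      = div2 (dirDeriv v) h (connection (dirDeriv v) h S)
          (cov1 (dirDeriv v) (connection (dirDeriv v) h S) σ) x b
        + div2 (dirDeriv v) h (connection (dirDeriv v) h S)
          (fun y a b => ∑ j, contorsion h S y a b j * σ y j) x b
        + 2 * ∑ j, raise1 h (fun y a => ∑ i, S y a i i) x j
          * cov1 (dirDeriv v) (connection (dirDeriv v) h S) σ x j b
        + 2 * ∑ k, ∑ j, contorsion h S x k b j * raise1 h (fun y a => ∑ i, S y a i i) x k * σ x j
        + ∑ k, ∑ l, ∑ j, (h x)⁻¹ k l * contorsion h S x k b j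
          * cov1 (dirDeriv v) (connection (dirDeriv v) h S) σ x l j
        + ∑ c, ∑ e, ∑ k, ∑ j, (h x)⁻¹ c e * contorsion h S x c b k * contorsion h S x e k j
          * σ x j := by
  set C := connection (dirDeriv v) h S with hCdef
  have sC : ∀ a b c, SmoothOn U fun y => C y a b c := smoothOn_connection hU h0 sh sS
  have dcov := fun a b => (smoothOn_cov1 (v := v) hU sC sσ a b).differentiableAt hU hx
  have dk : ∀ a b, DifferentiableAt ℝ (fun y => ∑ j, contorsion h S y a b j * σ y j) x :=
    fun a b => (SmoothOn.sum fun j =>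
      (smoothOn_contorsion h0 sh sS a b j).mul (sσ j)).differentiableAt hU hx
  -- As `Γ = C - 𝒦`, this is the Levi-Civita derivative of `σ` written with `C`. The outer
  -- derivative adds one contorsion term per index of `t` in `ec`.
  set t : E → ι → ι → ℝ :=
    fun y a b => cov1 (dirDeriv v) C σ y a b + ∑ j, contorsion h S y a b j * σ y j with ht
  have et : cov1 (dirDeriv v) (christoffel (dirDeriv v) h) σ = t := by
    funext y a b
    simp only [ht, cov1, contorsion_eq (D := dirDeriv v), sub_mul, Finset.sum_sub_distrib, ← hCdef]
    ring
  have ec : ∀ c a, cov2 (dirDeriv v) (christoffel (dirDeriv v) h) t x c a b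
      = cov2 (dirDeriv v) C t x c a b + ∑ j, contorsion h S x c a j * t x j b
        + ∑ j, contorsion h S x c b j * t x a j := by
    intro c a
    simp only [cov2, contorsion_eq (D := dirDeriv v), sub_mul, Finset.sum_sub_distrib, ← hCdef]
    ring
  -- The derivative index is contracted with the first index of `t`, so only the trace of the
  -- contorsion appears, which is twice the torsion trace.
  have p1 : ∑ a, ∑ c, (h x)⁻¹ a c * ∑ j, contorsion h S x c a j * t x j b
      = 2 * ∑ j, raise1 h (fun y a => ∑ i, S y a i i) x j * t x j b := by
    calc _ = ∑ j, (∑ a, ∑ c, (h x)⁻¹ a c * contorsion h S x c a j) * t x j b := by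
          simp only [Finset.mul_sum, Finset.sum_mul]
          rw [Finset.sum_congr rfl fun a _ => Finset.sum_comm, Finset.sum_comm]
          simp only [mul_assoc]
      _ = _ := by simp only [sum_inv_contorsion (h0 x hx) hs hS, Finset.mul_sum, mul_assoc]
  have p2 : ∑ a, ∑ c, (h x)⁻¹ a c * ∑ j, contorsion h S x c b j * t x a j
      = ∑ k, ∑ l, ∑ j, (h x)⁻¹ k l * contorsion h S x k b j * t x l j := by
    rw [Finset.sum_comm]
    simp only [Finset.mul_sum]
    refine Finset.sum_congr rfl fun c _ => Finset.sum_congr rfl fun a _ =>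
      Finset.sum_congr rfl fun j _ => ?_
    rw [inv_symm hs a c]
    ring
  have p3 := div2_add (v := v) (h := h) (C := C) dcov dk b
  rw [et]
  have e0 : div2 (dirDeriv v) h (christoffel (dirDeriv v) h) t x b
      = div2 (dirDeriv v) h C t x b
        + ∑ a, ∑ c, (h x)⁻¹ a c * ∑ j, contorsion h S x c a j * t x j b
        + ∑ a, ∑ c, (h x)⁻¹ a c * ∑ j, contorsion h S x c b j * t x a j := by
    simp only [div2, ec, mul_add, Finset.sum_add_distrib]
  rw [e0, p1, p2, p3]
  simp only [ht, mul_add, Finset.sum_add_distrib, Finset.mul_sum]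
  have q1 : ∑ i, ∑ j, 2 * (raise1 h (fun y a => ∑ i, S y a i i) x i
        * (contorsion h S x i b j * σ x j))
      = ∑ i, ∑ j, 2 * (contorsion h S x i b j
        * raise1 h (fun y a => ∑ i, S y a i i) x i * σ x j) :=
    Finset.sum_congr rfl fun _ _ => Finset.sum_congr rfl fun _ _ => by ring
  have q2 : ∑ k, ∑ l, ∑ j, ∑ i, (h x)⁻¹ k l * contorsion h S x k b j
        * (contorsion h S x l j i * σ x i)
      = ∑ c, ∑ e, ∑ k, ∑ j, (h x)⁻¹ c e * contorsion h S x c b k * contorsion h S x e k j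
        * σ x j := by simp only [mul_assoc]
  rw [q1, q2]
  ring

/-- The slice identity for `σ_b = S_{bi}^i`. -/
lemma torsion_trace_identity (hU : IsOpen U) (hx : x ∈ U) (h0 : ∀ y ∈ U, IsUnit (h y).det)
    (hs : ∀ y a b, h y a b = h y b a) (hS : ∀ y a b c, S y a b c = -S y b a c)
    (sh : ∀ a b, SmoothOn U fun y => h y a b) (sS : ∀ a b c, SmoothOn U fun y => S y a b c)
    {σ : E → ι → ℝ} (hσ : σ = fun y a => ∑ i, S y a i i)
    {C : E → ι → ι → ι → ℝ} (hC : C = connection (dirDeriv v) h S) (b : ι) :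
    div2 (dirDeriv v) h (christoffel (dirDeriv v) h)
        (cov1 (dirDeriv v) (christoffel (dirDeriv v) h) σ) x b
      - dirDeriv v b (div1 (dirDeriv v) h C σ) x
      = div2 (dirDeriv v) h C (cov1 (dirDeriv v) C σ) x b
        - div2 (dirDeriv v) h C (fun y a b => cov1 (dirDeriv v) C σ y b a) x b
        + ∑ j, ricci (dirDeriv v) C x b j * raise1 h σ x j
        + 2 * ∑ j, ∑ l, ∑ k, (h x)⁻¹ j l * S x b l k * cov1 (dirDeriv v) C σ x k j
        + div2 (dirDeriv v) h C (fun y a b => ∑ j, contorsion h S y a b j * σ y j) x b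
        + 2 * ∑ j, raise1 h σ x j * cov1 (dirDeriv v) C σ x j b
        + 2 * ∑ k, ∑ j, contorsion h S x k b j * raise1 h σ x k * σ x j
        + ∑ k, ∑ l, ∑ j, (h x)⁻¹ k l * contorsion h S x k b j * cov1 (dirDeriv v) C σ x l j
        + ∑ c, ∑ e, ∑ k, ∑ j, (h x)⁻¹ c e * contorsion h S x c b k * contorsion h S x e k j
          * σ x j := by
  subst hC
  have sσ : ∀ a, SmoothOn U fun y => σ y a := by
    subst hσ
    exact fun a => .sum fun i => sS a i i
  have sC : ∀ a b c, SmoothOn U fun y => connection (dirDeriv v) h S y a b c :=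
    smoothOn_connection hU h0 sh sS
  have e1 := div2_christoffel_cov1 (v := v) hU hx h0 (hs x) (hS x) sh sS sσ b
  have e2 := div2_transpose_cov1 (v := v) hU hx
    (fun y hy => compatibleAt_connection (h0 y hy) hs (hS y)) h0 (hs x) sh sC sσ
    (smoothOn_cov1 hU sC sσ) b
  -- The commutator term has `C_{cb} - C_{bc} = 2 S_{cb} = -2 S_{bc}`.
  have e3 : ∑ a, ∑ c, (h x)⁻¹ a c * ∑ s, (connection (dirDeriv v) h S x c b s
        - connection (dirDeriv v) h S x b c s) * cov1 (dirDeriv v) (connection (dirDeriv v) h S) σ x s a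
      = -(2 * ∑ j, ∑ l, ∑ k, (h x)⁻¹ j l * S x b l k
        * cov1 (dirDeriv v) (connection (dirDeriv v) h S) σ x k j) := by
    simp only [connection_torsion hs (hS x), hS x _ b, Finset.mul_sum, ← Finset.sum_neg_distrib]
    exact Finset.sum_congr rfl fun _ _ => Finset.sum_congr rfl fun _ _ =>
      Finset.sum_congr rfl fun _ _ => by ring
  rw [e1, e2, e3, ← hσ]
  ring

end TorsionIdentities

/-! ### The Gauss equation for the Ricci tensor in adapted coordinates -/

section Gauss

variable {d : ℕ}

/-- The coordinate vectors. -/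
abbrev coordDir (d : ℕ) (μ : Fin (d + 1)) : Coord d := EuclideanSpace.single μ 1

/-- The coordinate vectors tangent to the slices. -/
abbrev sliceDir (d : ℕ) (a : Fin d) : Coord d := EuclideanSpace.single a.succ 1

/-- Smooth components of a metric and a torsion tensor in adapted coordinates on the open set `U`. -/
structure AdaptedFields (U : Set (Coord d)) (g : Coord d → Matrix (Fin (d + 1)) (Fin (d + 1)) ℝ)
    (S : Coord d → Fin (d + 1) → Fin (d + 1) → Fin (d + 1) → ℝ) (n : Coord d → Fin (d + 1) → ℝ)
    (lapse : Coord d → ℝ) (shift : Coord d → Fin d → ℝ) : Prop where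
  isOpen : IsOpen U
  symm : ∀ x a b, g x a b = g x b a
  antisymm : ∀ x a b c, S x a b c = -S x b a c
  smoothMetric : ∀ a b, SmoothOn U fun x => g x a b
  smoothTorsion : ∀ a b c, SmoothOn U fun x => S x a b c
  adapted : IsAdapted g n U lapse shift

namespace AdaptedFields

variable {U : Set (Coord d)} {g : Coord d → Matrix (Fin (d + 1)) (Fin (d + 1)) ℝ}
    {S : Coord d → Fin (d + 1) → Fin (d + 1) → Fin (d + 1) → ℝ} {n : Coord d → Fin (d + 1) → ℝ}
    {lapse : Coord d → ℝ} {shift : Coord d → Fin d → ℝ} {x : Coord d}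

/-- `∇_μ n_b`. -/
def normalDeriv (g : Coord d → Matrix (Fin (d + 1)) (Fin (d + 1)) ℝ)
    (S : Coord d → Fin (d + 1) → Fin (d + 1) → Fin (d + 1) → ℝ) (n : Coord d → Fin (d + 1) → ℝ)
    (x : Coord d) (μ : Fin (d + 1)) (b : Fin d) : ℝ :=
  cov1 pd (connection pd g S) (normalForm g n) x μ b.succ

/-- The tangential part of `∇_μ e_b`. -/
def tangentDeriv (g : Coord d → Matrix (Fin (d + 1)) (Fin (d + 1)) ℝ)
    (S : Coord d → Fin (d + 1) → Fin (d + 1) → Fin (d + 1) → ℝ) (n : Coord d → Fin (d + 1) → ℝ)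
    (x : Coord d) (μ : Fin (d + 1)) (b : Fin d) (γ : Fin (d + 1)) : ℝ :=
  connection pd g S x μ b.succ γ - normalDeriv g S n x μ b * n x γ

/-- `n^μ S_{μb}^γ`. -/
def normalTorsion (S : Coord d → Fin (d + 1) → Fin (d + 1) → Fin (d + 1) → ℝ)
    (n : Coord d → Fin (d + 1) → ℝ) (x : Coord d) (b : Fin d) (γ : Fin (d + 1)) : ℝ :=
  ∑ μ, n x μ * S x μ b.succ γ

variable (H : AdaptedFields U g S n lapse shift)
include H

lemma normalForm_mul (hx : x ∈ U) : normalForm g n x 0 * n x 0 = -1 := by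
  have := H.adapted.unit x hx
  rw [Fin.sum_univ_succ] at this
  simpa [H.adapted.orthogonal x hx] using this

lemma lapse_mul (hx : x ∈ U) : lapse x * n x 0 = 1 := by
  have := H.adapted.time x hx 0
  simpa using this.symm

/-- Both `N` and `-n_0` are inverse to `n^0`. No orientation of `n`, hence no sign of the lapse, is
fixed. -/
lemma lapse_eq (hx : x ∈ U) : lapse x = -normalForm g n x 0 := by
  have h1 := H.normalForm_mul hx
  have h2 := H.lapse_mul hx
  have : n x 0 ≠ 0 := fun h => by simp [h] at h2
  apply mul_right_cancel₀ this
  linarith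

lemma lapse_ne_zero (hx : x ∈ U) : lapse x ≠ 0 := fun h => by
  simpa [h] using H.lapse_mul hx

lemma shift_eq (hx : x ∈ U) (a : Fin d) : shift x a = -(lapse x * n x a.succ) := by
  have := H.adapted.time x hx a.succ
  simp only [Fin.cons_succ, Pi.single_eq_of_ne (Fin.succ_ne_zero a)] at this
  linarith

lemma isUnit_det_inducedMetric (hx : x ∈ U) : IsUnit (inducedMetric g x).det :=
  (H.adapted.spacelike x hx).det_pos.ne'.isUnit

/-- A vector `w` in the kernel of `g` is orthogonal to `n`. As `n_α` has only the nonzero component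
`n_0`, this forces `w^0 = 0`; then `w` is tangent to the slice and is annihilated by the positive
definite `h`. -/
lemma isUnit_det (hx : x ∈ U) : IsUnit (g x).det := by
  rw [isUnit_iff_ne_zero]
  intro h0
  obtain ⟨w, hw, hw0⟩ := Matrix.exists_mulVec_eq_zero_iff.2 h0
  have hz : w 0 = 0 := by
    have e1 : ∑ α, n x α * (g x).mulVec w α = ∑ β, normalForm g n x β * w β := by
      simp only [Matrix.mulVec, dotProduct, normalForm, Finset.mul_sum, Finset.sum_mul]
      rw [Finset.sum_comm]
      exact Finset.sum_congr rfl fun β _ => Finset.sum_congr rfl fun α _ => by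
        rw [H.symm x α β]; ring
    rw [Fin.sum_univ_succ (f := fun β => normalForm g n x β * w β)] at e1
    simp only [hw0, H.adapted.orthogonal x hx, Pi.zero_apply, mul_zero, Finset.sum_const_zero,
      zero_mul, add_zero] at e1
    rcases mul_eq_zero.1 e1.symm with h | h
    · simpa [h] using H.normalForm_mul hx
    · exact h
  have hs : (inducedMetric g x).mulVec (fun c => w c.succ) = 0 := by
    ext a
    have := congrFun hw0 a.succ
    simp only [Matrix.mulVec, dotProduct, Fin.sum_univ_succ, hz, mul_zero, zero_add] at this
    exact this
  have ht : (fun c : Fin d => w c.succ) = 0 := by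
    have h1 := congrArg ((inducedMetric g x)⁻¹.mulVec ·) hs
    simpa [Matrix.mulVec_mulVec, Matrix.nonsing_inv_mul _ (H.isUnit_det_inducedMetric hx)] using h1
  refine hw (funext fun α => ?_)
  refine Fin.cases hz (fun c => congrFun ht c) α

lemma smoothOn_normal (α : Fin (d + 1)) : SmoothOn U fun y => n y α := H.adapted.smooth α

lemma smoothOn_normalForm (α : Fin (d + 1)) : SmoothOn U fun y => normalForm g n y α :=
  .sum fun β => (H.smoothMetric α β).mul (H.smoothOn_normal β)

/-- Smoothness of lapse and shift is not assumed but inherited from `n`, through `N = -n_0` and `β^a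
= -N n^a`. -/
lemma smoothOn_lapse : SmoothOn U lapse :=
  ((SmoothOn.const (-1)).mul (H.smoothOn_normalForm 0)).congr fun y hy => by
    rw [H.lapse_eq hy]; ring

lemma smoothOn_shift (a : Fin d) : SmoothOn U fun y => shift y a :=
  ((SmoothOn.const (-1)).mul (H.smoothOn_lapse.mul (H.smoothOn_normal a.succ))).congr
    fun y hy => by rw [H.shift_eq hy]; ring

lemma smoothOn_conn (a b c : Fin (d + 1)) : SmoothOn U fun y => connection pd g S y a b c :=
  smoothOn_connection (v := coordDir d) H.isOpen (fun _ hy => H.isUnit_det hy) H.smoothMetric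
    H.smoothTorsion a b c

lemma smoothOn_normalDeriv (μ : Fin (d + 1)) (b : Fin d) :
    SmoothOn U fun y => normalDeriv g S n y μ b :=
  smoothOn_cov1 (v := coordDir d) H.isOpen H.smoothOn_conn H.smoothOn_normalForm μ b.succ

lemma smoothOn_tangentDeriv (μ : Fin (d + 1)) (b : Fin d) (γ : Fin (d + 1)) :
    SmoothOn U fun y => tangentDeriv g S n y μ b γ :=
  (H.smoothOn_conn μ b.succ γ).sub ((H.smoothOn_normalDeriv μ b).mul (H.smoothOn_normal γ))

lemma compatibleAt (hx : x ∈ U) : CompatibleAt pd g (connection pd g S) x :=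
  compatibleAt_connection (H.isUnit_det hx) H.symm (H.antisymm x)

lemma pd_normalForm (hx : x ∈ U) (μ : Fin (d + 1)) (b : Fin d) :
    pd μ (fun y => normalForm g n y b.succ) x = 0 :=
  (dirDeriv_congr (coordDir d) μ H.isOpen hx fun y hy => H.adapted.orthogonal y hy b).trans
    (dirDeriv_const _ _ 0)

lemma normalDeriv_eq (hx : x ∈ U) (μ : Fin (d + 1)) (b : Fin d) :
    normalDeriv g S n x μ b
      = -∑ γ, connection pd g S x μ b.succ γ * normalForm g n x γ := by
  rw [normalDeriv, cov1, H.pd_normalForm hx, zero_sub]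

/-- Differentiating `g(e_b, n) = 0` turns the normal component of `∇_μ e_b` into `∇_μ n_b`, the sign
being fixed by `n_0 n^0 = -1`. The tangential part consequently has no `0`-component. -/
lemma connection_zero (hx : x ∈ U) (μ : Fin (d + 1)) (b : Fin d) :
    connection pd g S x μ b.succ 0 = normalDeriv g S n x μ b * n x 0 := by
  rw [H.normalDeriv_eq hx, Fin.sum_univ_succ]
  simp only [H.adapted.orthogonal x hx, mul_zero, Finset.sum_const_zero, add_zero]
  linear_combination (connection pd g S x μ b.succ 0) * H.normalForm_mul hx

lemma tangentDeriv_zero (hx : x ∈ U) (μ : Fin (d + 1)) (b : Fin d) :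
    tangentDeriv g S n x μ b 0 = 0 := by
  rw [tangentDeriv, H.connection_zero hx, sub_self]

lemma metric_succ_zero (hx : x ∈ U) (c : Fin d) :
    g x c.succ 0 = -(lapse x * ∑ s, inducedMetric g x c s * n x s.succ) := by
  have e := H.adapted.orthogonal x hx c
  rw [normalForm, Fin.sum_univ_succ] at e
  change g x c.succ 0 * n x 0 + ∑ s, inducedMetric g x c s * n x s.succ = 0 at e
  linear_combination lapse x * e - g x c.succ 0 * H.lapse_mul hx

/-- The coframe `e^c` is dual to the `e_a` and annihilates `n`; the latter is `e^c_0 = -N n^c`.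
Applied to `∇_a e_b` it therefore returns the tangential component, which `conn_eq_projection`
identifies with the induced connection. -/
lemma tangentDeriv_succ (hx : x ∈ U) (a b c : Fin d) :
    tangentDeriv g S n x a.succ b c.succ = (sliceFields g S n lapse shift).conn x a b c := by
  have hh := H.isUnit_det_inducedMetric hx
  rw [conn_eq_projection g S n lapse shift x (H.isUnit_det hx) hh, Fin.sum_univ_succ]
  have e0 : tangentCoframe g x c 0 = -(lapse x * n x c.succ) := by
    have : ∀ i, (inducedMetric g x)⁻¹ c i * g x i.succ 0
        = -(lapse x * ((inducedMetric g x)⁻¹ c i * ∑ s, inducedMetric g x i s * n x s.succ)) := by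
      intro i
      rw [H.metric_succ_zero hx i]; ring
    simp only [tangentCoframe, this, Finset.sum_neg_distrib, ← Finset.mul_sum]
    rw [sum_inv_lower hh (fun s => n x s.succ) c]
  have e1 : ∀ e : Fin d, tangentCoframe g x c e.succ = if c = e then 1 else 0 :=
    fun e => sum_inv_mul hh c e
  simp only [e0, e1, ite_mul, one_mul, zero_mul, Finset.sum_ite_eq, Finset.mem_univ, if_true,
    tangentDeriv, H.connection_zero hx]
  linear_combination normalDeriv g S n x a.succ b * n x c.succ * H.lapse_mul hx

/-- `g_{αγ} ∇_ν n^γ = ∇_ν n_α`. -/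
lemma sum_metric_covVec (hx : x ∈ U) (ν α : Fin (d + 1)) :
    ∑ γ, g x α γ * covVec pd (connection pd g S) n x ν γ
      = cov1 pd (connection pd g S) (normalForm g n) x ν α := by
  have e : pd ν (fun y => normalForm g n y α) x
      = ∑ β, pd ν (fun y => g y α β) x * n x β + ∑ β, g x α β * pd ν (fun y => n y β) x :=
    dirDeriv_sum_mul (coordDir d) ν
      (fun β => (H.smoothMetric α β).differentiableAt H.isOpen hx)
      (fun β => (H.smoothOn_normal β).differentiableAt H.isOpen hx)
  rw [cov1, e]
  simp only [H.compatibleAt hx ν α, covVec, normalForm, mul_add, add_mul, Finset.sum_add_distrib,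
    Finset.mul_sum, Finset.sum_mul]
  have r1 : ∑ γ, ∑ s, connection pd g S x ν α s * g x s γ * n x γ
      = ∑ s, ∑ γ, connection pd g S x ν α s * (g x s γ * n x γ) := by
    rw [Finset.sum_comm]; simp only [mul_assoc]
  have r2 : ∑ γ, ∑ s, connection pd g S x ν γ s * g x α s * n x γ
      = ∑ s, ∑ γ, g x α s * (connection pd g S x ν γ s * n x γ) := by
    rw [Finset.sum_comm]
    exact Finset.sum_congr rfl fun _ _ => Finset.sum_congr rfl fun _ _ => by ring
  rw [r1, r2]
  ring

/-- Differentiating `g(n, n) = -1` makes `∇_ν n` orthogonal to `n`, hence tangent to the slices. -/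
lemma covVec_zero (hx : x ∈ U) (ν : Fin (d + 1)) :
    covVec pd (connection pd g S) n x ν 0 = 0 := by
  have e : ∑ α, pd ν (fun y => normalForm g n y α) x * n x α
      + ∑ α, normalForm g n x α * pd ν (fun y => n y α) x = 0 :=
    (dirDeriv_sum_mul (coordDir d) ν
      (fun α => (H.smoothOn_normalForm α).differentiableAt H.isOpen hx)
      (fun α => (H.smoothOn_normal α).differentiableAt H.isOpen hx)).symm.trans <|
    (dirDeriv_congr (coordDir d) ν H.isOpen hx fun y hy => H.adapted.unit y hy).trans
      (dirDeriv_const _ _ (-1))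
  have e1 : ∑ α, cov1 pd (connection pd g S) (normalForm g n) x ν α * n x α
      = ∑ α, normalForm g n x α * covVec pd (connection pd g S) n x ν α := by
    simp only [← H.sum_metric_covVec hx, normalForm, Finset.sum_mul]
    rw [Finset.sum_comm]
    exact Finset.sum_congr rfl fun _ _ => Finset.sum_congr rfl fun _ _ => by
      rw [H.symm x]; ring
  have e2 : ∑ α, cov1 pd (connection pd g S) (normalForm g n) x ν α * n x α
      + ∑ α, normalForm g n x α * covVec pd (connection pd g S) n x ν α = 0 := by
    rw [← e]
    simp only [cov1, covVec, sub_mul, mul_add, Finset.sum_add_distrib, Finset.sum_sub_distrib,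
      Finset.sum_mul, Finset.mul_sum]
    have : ∑ α, ∑ c, connection pd g S x ν α c * normalForm g n x c * n x α
        = ∑ c, ∑ α, normalForm g n x c * (connection pd g S x ν α c * n x α) := by
      rw [Finset.sum_comm]
      exact Finset.sum_congr rfl fun _ _ => Finset.sum_congr rfl fun _ _ => by ring
    rw [this]
    ring
  rw [e1, Fin.sum_univ_succ] at e2
  simp only [H.adapted.orthogonal x hx, zero_mul, Finset.sum_const_zero, add_zero] at e2
  linear_combination (-(1 / 2) * n x 0) * e2
    + covVec pd (connection pd g S) n x ν 0 * H.normalForm_mul hx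

lemma covVec_succ (hx : x ∈ U) (ν : Fin (d + 1)) (c : Fin d) :
    covVec pd (connection pd g S) n x ν c.succ
      = ∑ b, (inducedMetric g x)⁻¹ c b * normalDeriv g S n x ν b := by
  rw [← sum_inv_lower (H.isUnit_det_inducedMetric hx)
    (fun c => covVec pd (connection pd g S) n x ν c.succ) c]
  refine Finset.sum_congr rfl fun b _ => ?_
  congr 1
  have := H.sum_metric_covVec hx ν b.succ
  rw [Fin.sum_univ_succ, H.covVec_zero hx, mul_zero, zero_add] at this
  exact this

lemma covVec_succ_succ (hx : x ∈ U) (a c : Fin d) :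
    covVec pd (connection pd g S) n x a.succ c.succ
      = raise2 (inducedMetric g) (secondForm g S n) x a c :=
  H.covVec_succ hx a.succ c

/-- `R(∂_ν, ∂_μ) e_b` in terms of the tangential and the normal part of `∇_μ e_b`. -/
lemma riemann_split (hx : x ∈ U) (μ ν : Fin (d + 1)) (b : Fin d) (γ : Fin (d + 1)) :
    riemann pd (connection pd g S) x μ ν b.succ γ
      = pd ν (fun y => tangentDeriv g S n y μ b γ) x
        - pd μ (fun y => tangentDeriv g S n y ν b γ) x
        + (∑ s : Fin d, tangentDeriv g S n x ν s γ * tangentDeriv g S n x μ b s.succ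
          - ∑ s : Fin d, tangentDeriv g S n x μ s γ * tangentDeriv g S n x ν b s.succ)
        + normalDeriv g S n x μ b * covVec pd (connection pd g S) n x ν γ
        - normalDeriv g S n x ν b * covVec pd (connection pd g S) n x μ γ
        + n x γ * (pd ν (fun y => normalDeriv g S n y μ b) x
          - pd μ (fun y => normalDeriv g S n y ν b) x
          + (∑ s : Fin d, normalDeriv g S n x ν s * tangentDeriv g S n x μ b s.succ
          - ∑ s : Fin d, normalDeriv g S n x μ s * tangentDeriv g S n x ν b s.succ)) := by
  have e1 : ∀ μ ν, pd ν (fun y => connection pd g S y μ b.succ γ) x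
      = pd ν (fun y => tangentDeriv g S n y μ b γ) x
        + (pd ν (fun y => normalDeriv g S n y μ b) x * n x γ
          + normalDeriv g S n x μ b * pd ν (fun y => n y γ) x) := by
    intro μ ν
    have dk := (H.smoothOn_normalDeriv μ b).differentiableAt H.isOpen hx
    have dn := (H.smoothOn_normal γ).differentiableAt H.isOpen hx
    have dt := (H.smoothOn_tangentDeriv μ b γ).differentiableAt H.isOpen hx
    have a1 := dirDeriv_add (coordDir d) ν dt (dk.fun_mul dn)
    rw [dirDeriv_mul (coordDir d) ν dk dn] at a1
    refine Eq.trans ?_ a1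
    exact dirDeriv_congr (coordDir d) ν H.isOpen hx fun y _ => by rw [tangentDeriv]; ring
  have e2 : ∀ μ ν, ∑ s, connection pd g S x ν s γ * connection pd g S x μ b.succ s
      = ∑ s : Fin d, tangentDeriv g S n x ν s γ * tangentDeriv g S n x μ b s.succ
        + n x γ * ∑ s : Fin d, normalDeriv g S n x ν s * tangentDeriv g S n x μ b s.succ
        + normalDeriv g S n x μ b * ∑ s, connection pd g S x ν s γ * n x s := by
    intro μ ν
    have a1 : ∀ s, connection pd g S x μ b.succ s
        = tangentDeriv g S n x μ b s + normalDeriv g S n x μ b * n x s := by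
      intro s; rw [tangentDeriv]; ring
    have a2 : ∀ s : Fin d, connection pd g S x ν s.succ γ
        = tangentDeriv g S n x ν s γ + normalDeriv g S n x ν s * n x γ := by
      intro s; rw [tangentDeriv]; ring
    -- The `0`-component of the tangential part vanishes, so the sum reduces to slice indices and
    -- `∇_ν e_s` can be split again.
    have a3 : ∑ s, connection pd g S x ν s γ * tangentDeriv g S n x μ b s
        = ∑ s : Fin d, tangentDeriv g S n x ν s γ * tangentDeriv g S n x μ b s.succ
        + n x γ * ∑ s : Fin d, normalDeriv g S n x ν s * tangentDeriv g S n x μ b s.succ := by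
      rw [Fin.sum_univ_succ, H.tangentDeriv_zero hx, mul_zero, zero_add, Finset.mul_sum,
        ← Finset.sum_add_distrib]
      exact Finset.sum_congr rfl fun s _ => by rw [a2]; ring
    rw [← a3, Finset.mul_sum, ← Finset.sum_add_distrib]
    exact Finset.sum_congr rfl fun s _ => by rw [a1]; ring
  rw [riemann, Finset.sum_sub_distrib, e1, e1, e2, e2, covVec, covVec]
  ring

lemma acceleration_eq (hx : x ∈ U) (b : Fin d) :
    acceleration g S n x b = ∑ ν, n x ν * normalDeriv g S n x ν b := by
  simp only [acceleration, normalDeriv, ← H.sum_metric_covVec hx, Finset.mul_sum]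
  rw [Finset.sum_comm]
  exact Finset.sum_congr rfl fun _ _ => Finset.sum_congr rfl fun _ _ => by ring

/-- `∇_0 n_b = N a_b + β^i K_{ib}`. -/
lemma normalDeriv_zero (hx : x ∈ U) (b : Fin d) :
    normalDeriv g S n x 0 b = lapse x * acceleration g S n x b
      + ∑ i, shift x i * secondForm g S n x i b := by
  have e : ∑ i, shift x i * secondForm g S n x i b
      = -(lapse x * ∑ i : Fin d, n x i.succ * normalDeriv g S n x i.succ b) := by
    rw [Finset.mul_sum, ← Finset.sum_neg_distrib]
    exact Finset.sum_congr rfl fun i _ => by rw [H.shift_eq hx, secondForm, normalDeriv]; ring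
  rw [e, H.acceleration_eq hx, Fin.sum_univ_succ]
  linear_combination (-normalDeriv g S n x 0 b) * H.lapse_mul hx

/-- The decomposition of `∂_0` into lapse and shift parts, tested on a covector. -/
lemma time_succ (hx : x ∈ U) (f : Fin (d + 1) → ℝ) :
    f 0 = lapse x * ∑ μ, n x μ * f μ + ∑ i : Fin d, shift x i * f i.succ := by
  have e : ∑ i : Fin d, shift x i * f i.succ = -(lapse x * ∑ i : Fin d, n x i.succ * f i.succ) := by
    rw [Finset.mul_sum, ← Finset.sum_neg_distrib]
    exact Finset.sum_congr rfl fun i _ => by rw [H.shift_eq hx]; ring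
  rw [e, Fin.sum_univ_succ]
  linear_combination (-f 0) * H.lapse_mul hx

/-- `∇_0 e_b - β^i ∇_i e_b = N ∇_b n + (∂_b N) n + (∂_b β^i) e_i + 2 N S(n, e_b)`. -/
lemma connection_time (hx : x ∈ U) (b : Fin d) (γ : Fin (d + 1)) :
    connection pd g S x 0 b.succ γ
      = lapse x * covVec pd (connection pd g S) n x b.succ γ + spd b lapse x * n x γ
        + (Fin.cons 0 fun c => spd b (fun y => shift y c) x : Fin (d + 1) → ℝ) γ
        + ∑ i, shift x i * connection pd g S x i.succ b.succ γ
        + 2 * lapse x * normalTorsion S n x b γ := by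
  -- Coordinate fields commute, so exchanging the two directions costs only the torsion.
  have t1 : ∀ μ, connection pd g S x μ b.succ γ
      = connection pd g S x b.succ μ γ + 2 * S x μ b.succ γ := by
    intro μ
    have := connection_torsion (D := pd) H.symm (H.antisymm x) μ b.succ γ
    linarith
  have t2 := H.time_succ hx fun μ => connection pd g S x b.succ μ γ
  have t3 := H.time_succ hx fun μ => S x μ b.succ γ
  have dN := H.smoothOn_lapse.differentiableAt H.isOpen hx
  have dn := (H.smoothOn_normal γ).differentiableAt H.isOpen hx
  -- Derivative of `∂_0 = N n + β^i e_i`, whose left side has constant components.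
  have t4 : spd b lapse x * n x γ + lapse x * spd b (fun y => n y γ) x
      + (Fin.cons 0 fun c => spd b (fun y => shift y c) x : Fin (d + 1) → ℝ) γ = 0 := by
    have a1 : spd b (fun y => lapse y * n y γ) x
        = spd b lapse x * n x γ + lapse x * spd b (fun y => n y γ) x :=
      dirDeriv_mul (sliceDir d) b dN dn
    rw [← a1]
    refine Fin.cases ?_ (fun c => ?_) γ
    · have : spd b (fun y => lapse y * n y 0) x = 0 :=
        (dirDeriv_congr (sliceDir d) b H.isOpen hx fun y hy => H.lapse_mul hy).trans
          (dirDeriv_const _ _ 1)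
      simp [this]
    · have dm := H.smoothOn_lapse.differentiableAt H.isOpen hx |>.fun_mul
        ((H.smoothOn_normal c.succ).differentiableAt H.isOpen hx)
      have : spd b (fun y => shift y c) x = -1 * spd b (fun y => lapse y * n y c.succ) x :=
        (dirDeriv_congr (sliceDir d) b H.isOpen hx fun y hy => by
          rw [H.shift_eq hy c]; ring).trans (dirDeriv_const_mul (sliceDir d) b (-1) dm)
      simp only [Fin.cons_succ, this]
      ring
  have t5 : ∑ i, shift x i * connection pd g S x i.succ b.succ γ
      = ∑ i, shift x i * connection pd g S x b.succ i.succ γ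
        + 2 * ∑ i : Fin d, shift x i * S x i.succ b.succ γ := by
    rw [Finset.mul_sum, ← Finset.sum_add_distrib]
    exact Finset.sum_congr rfl fun i _ => by rw [t1]; ring
  have t6 : covVec pd (connection pd g S) n x b.succ γ
      = spd b (fun y => n y γ) x + ∑ μ, n x μ * connection pd g S x b.succ μ γ := by
    rw [covVec]
    congr 1
    exact Finset.sum_congr rfl fun _ _ => mul_comm _ _
  rw [t1, t5, t6, normalTorsion]
  linear_combination t2 + 2 * t3 - t4

/-- Antisymmetry gives `S_{b00} = -n_s S(n, e_b)^s`, and only `n_0 = -N` contributes. -/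
lemma torsiona00_eq (hx : x ∈ U) (b : Fin d) :
    torsiona00 g S n x b = lapse x * normalTorsion S n x b 0 := by
  have e : torsiona00 g S n x b = -∑ s, normalForm g n x s * normalTorsion S n x b s := by
    simp only [torsiona00, lowerTorsion, normalForm, normalTorsion, Finset.mul_sum, Finset.sum_mul,
      ← Finset.sum_neg_distrib]
    rw [Finset.sum_congr rfl fun μ _ => Finset.sum_comm, Finset.sum_comm]
    refine Finset.sum_congr rfl fun s _ => Finset.sum_congr rfl fun μ _ =>
      Finset.sum_congr rfl fun ν _ => ?_
    rw [H.antisymm x b.succ μ s, H.symm x ν s]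
    ring
  rw [e, Fin.sum_univ_succ, H.lapse_eq hx]
  simp only [H.adapted.orthogonal x hx, zero_mul, Finset.sum_const_zero]
  ring

/-- `∂_b N = N (a_b - 2 S_b)`. -/
lemma spd_lapse (hx : x ∈ U) (b : Fin d) :
    spd b lapse x = lapse x * (acceleration g S n x b - 2 * torsiona00 g S n x b) := by
  -- The `0`-component detects the part along `n`: the induced derivatives and `∇_b n` drop out.
  have e := H.connection_time hx b 0
  have e1 : ∑ i, shift x i * connection pd g S x i.succ b.succ 0
      = (∑ i, shift x i * secondForm g S n x i b) * n x 0 := by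
    rw [Finset.sum_mul]
    exact Finset.sum_congr rfl fun i _ => by
      rw [H.connection_zero hx, secondForm, normalDeriv]; ring
  rw [H.connection_zero hx, e1, H.covVec_zero hx, H.normalDeriv_zero hx, Fin.cons_zero] at e
  rw [H.torsiona00_eq hx]
  linear_combination (-lapse x) * e + (lapse x * acceleration g S n x b - spd b lapse x)
    * H.lapse_mul hx

/-- `S(n, e_b)^s - S_b n^s = h^{sc} S_{0bc}`. -/
lemma normalTorsion_succ (hx : x ∈ U) (b s : Fin d) :
    normalTorsion S n x b s.succ - torsiona00 g S n x b * n x s.succ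
      = ∑ c, (inducedMetric g x)⁻¹ s c * torsion0ab g S n x b c := by
  rw [← sum_inv_lower (H.isUnit_det_inducedMetric hx)
    (fun s => normalTorsion S n x b s.succ - torsiona00 g S n x b * n x s.succ) s]
  refine Finset.sum_congr rfl fun c _ => ?_
  congr 1
  have e : torsion0ab g S n x b c = ∑ s, g x c.succ s * normalTorsion S n x b s := by
    simp only [torsion0ab, lowerTorsion, normalTorsion, Finset.mul_sum]
    rw [Finset.sum_comm]
    exact Finset.sum_congr rfl fun _ _ => Finset.sum_congr rfl fun _ _ => by ring
  rw [e, Fin.sum_univ_succ, H.metric_succ_zero hx, H.torsiona00_eq hx]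
  simp only [mul_sub, Finset.sum_sub_distrib]
  have : ∑ t : Fin d, inducedMetric g x c t * (lapse x * normalTorsion S n x b 0 * n x t.succ)
      = lapse x * (∑ t : Fin d, inducedMetric g x c t * n x t.succ) * normalTorsion S n x b 0 := by
    rw [Finset.mul_sum, Finset.sum_mul]
    exact Finset.sum_congr rfl fun _ _ => by ring
  rw [this]
  simp only [inducedMetric]
  ring

/-- The tangential part of `∇_0 e_b - β^i ∇_i e_b`. -/
lemma tangentDeriv_time (hx : x ∈ U) (b c : Fin d) :
    tangentDeriv g S n x 0 b c.succ
      = ∑ i, shift x i * tangentDeriv g S n x i.succ b c.succ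
        + lapse x * raise2 (inducedMetric g) (secondForm g S n) x b c
        + spd b (fun y => shift y c) x
        + 2 * lapse x * ∑ e, (inducedMetric g x)⁻¹ c e * torsion0ab g S n x b e := by
  have e := H.connection_time hx b c.succ
  have e1 : ∑ i, shift x i * connection pd g S x i.succ b.succ c.succ
      = ∑ i, shift x i * tangentDeriv g S n x i.succ b c.succ
        + (∑ i, shift x i * secondForm g S n x i b) * n x c.succ := by
    rw [Finset.sum_mul, ← Finset.sum_add_distrib]
    exact Finset.sum_congr rfl fun i _ => by rw [tangentDeriv, normalDeriv, secondForm]; ring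
  rw [e1, H.covVec_succ_succ hx, H.spd_lapse hx, Fin.cons_succ] at e
  rw [tangentDeriv, H.normalDeriv_zero hx, ← H.normalTorsion_succ hx]
  linear_combination e

/-- `K_{ab}` is symmetric if `S_{ab0} = 0`. -/
lemma secondForm_symm (h0 : ∀ y ∈ U, ∀ a b, torsionab0 g S n y a b = 0) (hx : x ∈ U)
    (a b : Fin d) : secondForm g S n x a b = secondForm g S n x b a := by
  have e := h0 x hx a b
  have e1 : torsionab0 g S n x a b = ∑ γ, S x a.succ b.succ γ * normalForm g n x γ := by
    simp only [torsionab0, lowerTorsion, normalForm, Finset.mul_sum]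
    rw [Finset.sum_comm]
    exact Finset.sum_congr rfl fun γ _ => Finset.sum_congr rfl fun δ _ => by
      rw [H.symm x δ γ]; ring
  have e2 : 2 * ∑ γ, S x a.succ b.succ γ * normalForm g n x γ
      = ∑ γ, connection pd g S x a.succ b.succ γ * normalForm g n x γ
        - ∑ γ, connection pd g S x b.succ a.succ γ * normalForm g n x γ := by
    rw [Finset.mul_sum, ← Finset.sum_sub_distrib]
    exact Finset.sum_congr rfl fun γ _ => by
      rw [← sub_mul, connection_torsion (D := pd) H.symm (H.antisymm x)]; ring
  have e3 := H.normalDeriv_eq hx a.succ b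
  have e4 := H.normalDeriv_eq hx b.succ a
  simp only [normalDeriv] at e3 e4
  rw [secondForm, secondForm, e3, e4]
  linarith

lemma smoothOn_acceleration (b : Fin d) : SmoothOn U fun y => acceleration g S n y b :=
  (SmoothOn.sum fun ν => (H.smoothOn_normal ν).mul (H.smoothOn_normalDeriv ν b)).congr
    fun _ hy => H.acceleration_eq hy b

lemma smoothOn_secondForm (a b : Fin d) : SmoothOn U fun y => secondForm g S n y a b :=
  H.smoothOn_normalDeriv a.succ b

lemma spd_normalDeriv_zero (hx : x ∈ U) (a b : Fin d) :
    spd a (fun y => normalDeriv g S n y 0 b) x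
      = spd a lapse x * acceleration g S n x b
        + lapse x * spd a (fun y => acceleration g S n y b) x
        + (∑ i, spd a (fun y => shift y i) x * secondForm g S n x i b
          + ∑ i, shift x i * spd a (fun y => secondForm g S n y i b) x) := by
  have dN := H.smoothOn_lapse.differentiableAt H.isOpen hx
  have da := (H.smoothOn_acceleration b).differentiableAt H.isOpen hx
  have ds := fun i => (H.smoothOn_shift i).differentiableAt H.isOpen hx
  have dK := fun i => (H.smoothOn_secondForm i b).differentiableAt H.isOpen hx
  have e := dirDeriv_add (sliceDir d) a (dN.fun_mul da)
    (DifferentiableAt.fun_sum (u := Finset.univ) fun i _ => (ds i).fun_mul (dK i))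
  rw [dirDeriv_mul _ _ dN da, dirDeriv_sum_mul _ _ ds dK] at e
  exact (dirDeriv_congr (sliceDir d) a H.isOpen hx fun y hy => H.normalDeriv_zero hy b).trans e

lemma lieZeroK_symm (h0 : ∀ y ∈ U, ∀ a b, torsionab0 g S n y a b = 0) (hx : x ∈ U)
    (a b : Fin d) : (sliceFields g S n lapse shift).lieZeroK x a b
      = (sliceFields g S n lapse shift).lieZeroK x b a := by
  have hks : ∀ y ∈ U, ∀ a b, (sliceFields g S n lapse shift).K y a b
      = (sliceFields g S n lapse shift).K y b a := fun y hy => H.secondForm_symm h0 hy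
  have e : pd 0 (fun y => (sliceFields g S n lapse shift).K y a b) x
      = pd 0 (fun y => (sliceFields g S n lapse shift).K y b a) x :=
    dirDeriv_congr (coordDir d) 0 H.isOpen hx fun y hy => hks y hy a b
  have e' : ∀ i, spd i (fun y => (sliceFields g S n lapse shift).K y a b) x
      = spd i (fun y => (sliceFields g S n lapse shift).K y b a) x := fun i =>
    dirDeriv_congr (sliceDir d) i H.isOpen hx fun y hy => hks y hy a b
  simp only [SliceFields.lieZeroK, e, e']
  congr 1
  refine Finset.sum_congr rfl fun i _ => ?_
  rw [hks x hx i b, hks x hx a i]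
  ring

/-- The tangential Ricci tensor of the spacetime through that of the slices. -/
theorem ricci_succ (h0 : ∀ y ∈ U, ∀ a b, torsionab0 g S n y a b = 0) (hx : x ∈ U)
    (a b : Fin d) :
    ricci pd (connection pd g S) x a.succ b.succ
      = ricci spd (sliceFields g S n lapse shift).conn x a b
        + (sliceFields g S n lapse shift).bracket x b a := by
  have hN := H.lapse_ne_zero hx
  set P := sliceFields g S n lapse shift with hP
  have hconn : ∀ y ∈ U, ∀ a b c, tangentDeriv g S n y a.succ b c.succ = P.conn y a b c :=
    fun y hy => H.tangentDeriv_succ hy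
  have dconn : ∀ i a b c, pd i.succ (fun y => tangentDeriv g S n y a.succ b c.succ) x
      = spd i (fun y => P.conn y a b c) x := fun i a b c =>
    dirDeriv_congr (sliceDir d) i H.isOpen hx fun y hy => hconn y hy a b c
  have dzero : ∀ μ ν b, pd μ (fun y => tangentDeriv g S n y ν b 0) x = 0 := fun μ ν b =>
    (dirDeriv_congr (coordDir d) μ H.isOpen hx fun y hy => H.tangentDeriv_zero hy ν b).trans
      (dirDeriv_const _ _ 0)
  have hk : ∀ y (i j : Fin d), normalDeriv g S n y i.succ j = P.K y i j := fun _ _ _ => rfl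
  have hks : ∀ y ∈ U, ∀ a b, P.K y a b = P.K y b a := fun y hy => H.secondForm_symm h0 hy
  -- The Codazzi part: the coefficient of `n^γ` in `riemann_split`. Tracing the curvature contracts
  -- it with `n`, which lapse and shift convert in `z` into a derivative along `∂_0 - β`.
  set Z : Fin (d + 1) → ℝ := fun ν => pd ν (fun y => normalDeriv g S n y a.succ b) x
    - pd a.succ (fun y => normalDeriv g S n y ν b) x
    + (∑ s : Fin d, normalDeriv g S n x ν s * tangentDeriv g S n x a.succ b s.succ
      - ∑ s : Fin d, normalDeriv g S n x a.succ s * tangentDeriv g S n x ν b s.succ) with hZ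
  have r0 : riemann pd (connection pd g S) x a.succ 0 b.succ 0 = n x 0 * Z 0 := by
    rw [H.riemann_split hx]
    simp only [dzero, H.tangentDeriv_zero hx, H.covVec_zero hx, zero_mul, mul_zero,
      Finset.sum_const_zero, hZ]
    ring
  have r1 : ∀ i : Fin d, riemann pd (connection pd g S) x a.succ i.succ b.succ i.succ
      = riemann spd P.conn x a i b i + P.K x a b * raise2 P.h P.K x i i
        - P.K x i b * raise2 P.h P.K x a i + n x i.succ * Z i.succ := by
    intro i
    rw [H.riemann_split hx, riemann, Finset.sum_sub_distrib]
    simp only [dconn, hconn x hx, H.covVec_succ_succ hx, hk, hZ]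
    rfl
  have z : n x 0 * Z 0 + ∑ i : Fin d, n x i.succ * Z i.succ
      = 1 / lapse x * (Z 0 - ∑ i : Fin d, shift x i * Z i.succ) := by
    have e : ∑ i : Fin d, shift x i * Z i.succ
        = -(lapse x * ∑ i : Fin d, n x i.succ * Z i.succ) := by
      rw [Finset.mul_sum, ← Finset.sum_neg_distrib]
      exact Finset.sum_congr rfl fun i _ => by rw [H.shift_eq hx]; ring
    have e' : n x 0 = 1 / lapse x := by
      field_simp
      linarith [H.lapse_mul hx]
    rw [e, e']
    field_simp
    ring
  -- The connection terms carrying the shift cancel between `Z 0` and `β^i Z_i`. The remaining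
  -- derivatives of `K` and `β` assemble into `ℒ_0 K`, those of `N a_b` into `∂_a N a_b` and `N D_a
  -- a_b`.
  have z0 : Z 0 - ∑ i : Fin d, shift x i * Z i.succ
      = P.lieZeroK x a b - spd a lapse x * P.acc x b - lapse x * cov1 spd P.conn P.acc x a b
        - lapse x * ∑ s, P.K x a s * raise2 P.h P.K x b s
        - 2 * lapse x * ∑ c, P.S0 x b c * raise2 P.h P.K x a c := by
    have t1 : ∑ s : Fin d, normalDeriv g S n x 0 s * tangentDeriv g S n x a.succ b s.succ
        = lapse x * ∑ s, P.conn x a b s * P.acc x s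
          + ∑ i, shift x i * ∑ s, P.K x i s * P.conn x a b s := by
      have : ∑ i, shift x i * ∑ s, P.K x i s * P.conn x a b s
          = ∑ s, (∑ i, shift x i * P.K x i s) * P.conn x a b s := by
        simp only [Finset.mul_sum, Finset.sum_mul]
        rw [Finset.sum_comm]
        simp only [mul_assoc]
      rw [this, Finset.mul_sum, ← Finset.sum_add_distrib]
      refine Finset.sum_congr rfl fun s _ => ?_
      rw [H.normalDeriv_zero hx, hconn x hx]
      change (lapse x * P.acc x s + ∑ i, shift x i * P.K x i s) * _ = _
      ring
    have t2 : ∑ s : Fin d, normalDeriv g S n x a.succ s * tangentDeriv g S n x 0 b s.succ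
        = ∑ i, shift x i * ∑ s, P.K x a s * P.conn x i b s
          + lapse x * ∑ s, P.K x a s * raise2 P.h P.K x b s
          + ∑ s, P.K x a s * spd b (fun y => shift y s) x
          + 2 * lapse x * ∑ c, P.S0 x b c * raise2 P.h P.K x a c := by
      have q1 : ∑ i, shift x i * ∑ s, P.K x a s * P.conn x i b s
          = ∑ s, P.K x a s * ∑ i, shift x i * P.conn x i b s := by
        simp only [Finset.mul_sum]
        rw [Finset.sum_comm]
        simp only [mul_left_comm]
      have q2 : ∑ c, P.S0 x b c * raise2 P.h P.K x a c
          = ∑ s, P.K x a s * ∑ e, (P.h x)⁻¹ s e * P.S0 x b e := by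
        simp only [raise2, Finset.mul_sum]
        rw [Finset.sum_comm]
        refine Finset.sum_congr rfl fun s _ => Finset.sum_congr rfl fun c _ => ?_
        rw [inv_symm (h := P.h) (fun a b => H.symm x _ _) c s]
        ring
      rw [q1, q2, Finset.mul_sum, Finset.mul_sum, ← Finset.sum_add_distrib,
        ← Finset.sum_add_distrib, ← Finset.sum_add_distrib]
      refine Finset.sum_congr rfl fun s _ => ?_
      rw [H.tangentDeriv_time hx, hk]
      simp only [hconn x hx]
      change _ * (_ + lapse x * raise2 P.h P.K x b s + _
        + 2 * lapse x * ∑ e, (P.h x)⁻¹ s e * P.S0 x b e) = _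
      ring
    have t3 := H.spd_normalDeriv_zero hx a b
    have t4 : ∀ i : Fin d, Z i.succ = spd i (fun y => P.K y a b) x - spd a (fun y => P.K y i b) x
        + (∑ s, P.K x i s * P.conn x a b s - ∑ s, P.K x a s * P.conn x i b s) := by
      intro i
      simp only [hZ, hconn x hx, hk]
      rfl
    have t5 : Z 0 = pd 0 (fun y => P.K y a b) x - (spd a lapse x * P.acc x b
        + lapse x * spd a (fun y => P.acc y b) x
        + (∑ i, spd a (fun y => shift y i) x * P.K x i b
          + ∑ i, shift x i * spd a (fun y => P.K y i b) x))
        + (lapse x * ∑ s, P.conn x a b s * P.acc x s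
          + ∑ i, shift x i * ∑ s, P.K x i s * P.conn x a b s
        - (∑ i, shift x i * ∑ s, P.K x a s * P.conn x i b s
          + lapse x * ∑ s, P.K x a s * raise2 P.h P.K x b s
          + ∑ s, P.K x a s * spd b (fun y => shift y s) x
          + 2 * lapse x * ∑ c, P.S0 x b c * raise2 P.h P.K x a c)) := by
      rw [← t1, ← t2]
      exact congrArg (fun q => pd 0 (fun y => P.K y a b) x - q + _) t3
    have t6 : P.lieZeroK x a b = pd 0 (fun y => P.K y a b) x
        - (∑ i, shift x i * spd i (fun y => P.K y a b) x
          + ∑ i, spd a (fun y => shift y i) x * P.K x i b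
          + ∑ i, P.K x a i * spd b (fun y => shift y i) x) := by
      simp only [← Finset.sum_add_distrib, mul_comm (spd a _ x)]
      rfl
    rw [t5, t6, cov1]
    simp only [t4, mul_add, mul_sub, Finset.sum_add_distrib, Finset.sum_sub_distrib]
    ring
  have lie : P.lieZeroK x b a = P.lieZeroK x a b := H.lieZeroK_symm h0 hx b a
  have kk : ∑ i, ∑ j, (P.h x)⁻¹ i j * P.K x j b * P.K x a i
      = ∑ i, P.K x i b * raise2 P.h P.K x a i := by
    rw [Finset.sum_comm]
    simp only [raise2, Finset.mul_sum]
    refine Finset.sum_congr rfl fun i _ => Finset.sum_congr rfl fun j _ => ?_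
    rw [inv_symm (h := P.h) (fun a b => H.symm x _ _) i j]
    ring
  have kk' : ∑ s, P.K x a s * raise2 P.h P.K x b s = ∑ i, P.K x i b * raise2 P.h P.K x a i := by
    rw [← kk]
    simp only [raise2, Finset.mul_sum]
    refine Finset.sum_congr rfl fun i _ => Finset.sum_congr rfl fun j _ => ?_
    rw [show P.K x b j = P.K x j b from hks x hx b j]
    ring
  have tr : ∑ i, raise2 P.h P.K x i i = trace2 P.h P.K x := rfl
  have lapseD : spd a lapse x = lapse x * (P.acc x a - 2 * P.Sn x a) := H.spd_lapse hx a
  have ric : ricci pd (connection pd g S) x a.succ b.succ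
      = ricci spd P.conn x a b + P.K x a b * trace2 P.h P.K x
        - ∑ i, P.K x i b * raise2 P.h P.K x a i
        + 1 / lapse x * (Z 0 - ∑ i : Fin d, shift x i * Z i.succ) := by
    rw [ricci, Fin.sum_univ_succ, r0, ← z, ricci, ← tr]
    simp only [r1, Finset.sum_add_distrib, Finset.sum_sub_distrib, Finset.mul_sum]
    ring
  -- One quadratic term in `K` comes from the tangential curvature and one from `z0`, hence the
  -- factor 2. Inserting `∂_a N = N (a_a - 2 S_a)` produces `-a_a a_b + 2 S_a a_b`.
  rw [ric, z0, SliceFields.bracket, kk, lie, kk', lapseD, show P.K x b a = P.K x a b from hks x hx b a,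
    show P.lapse x = lapse x from rfl]
  field_simp
  ring

end AdaptedFields

end Gauss

/-! ### `F` depends only on the first jets of the fields -/

section Jets

variable {d : ℕ} {f g f' g' : Coord d → ℝ} {x : Coord d}

namespace SameJet

/-- Two functions share a first jet when they share a value and a derivative `L`; each closure rule
below is then a derivative rule applied to both functions with the same `L`. -/
lemma of_hasFDerivAt {L : Coord d →L[ℝ] ℝ} (hf : HasFDerivAt f L x) (hg : HasFDerivAt g L x)
    (h : f x = g x) : SameJet f g x :=
  ⟨hf.differentiableAt, hg.differentiableAt, h, hf.fderiv.trans hg.fderiv.symm⟩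

lemma exists_hasFDerivAt (H : SameJet f g x) :
    ∃ L : Coord d →L[ℝ] ℝ, HasFDerivAt f L x ∧ HasFDerivAt g L x :=
  ⟨fderiv ℝ f x, H.1.hasFDerivAt, H.2.2.2 ▸ H.2.1.hasFDerivAt⟩

lemma value (H : SameJet f g x) : f x = g x := H.2.2.1

lemma pd_eq (H : SameJet f g x) (μ : Fin (d + 1)) : pd μ f x = pd μ g x := by
  rw [pd, pd, H.2.2.2]

lemma spd_eq (H : SameJet f g x) (a : Fin d) : spd a f x = spd a g x := H.pd_eq _

lemma const (c : ℝ) : SameJet (fun _ : Coord d => c) (fun _ => c) x :=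
  of_hasFDerivAt (hasFDerivAt_const c x) (hasFDerivAt_const c x) rfl

lemma add (H : SameJet f g x) (H' : SameJet f' g' x) :
    SameJet (fun y => f y + f' y) (fun y => g y + g' y) x := by
  obtain ⟨L, h1, h2⟩ := H.exists_hasFDerivAt
  obtain ⟨L', h1', h2'⟩ := H'.exists_hasFDerivAt
  exact of_hasFDerivAt (h1.fun_add h1') (h2.fun_add h2') (by rw [H.value, H'.value])

lemma sub (H : SameJet f g x) (H' : SameJet f' g' x) :
    SameJet (fun y => f y - f' y) (fun y => g y - g' y) x := by
  obtain ⟨L, h1, h2⟩ := H.exists_hasFDerivAt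
  obtain ⟨L', h1', h2'⟩ := H'.exists_hasFDerivAt
  exact of_hasFDerivAt (h1.fun_sub h1') (h2.fun_sub h2') (by rw [H.value, H'.value])

lemma mul (H : SameJet f g x) (H' : SameJet f' g' x) :
    SameJet (fun y => f y * f' y) (fun y => g y * g' y) x := by
  obtain ⟨L, h1, h2⟩ := H.exists_hasFDerivAt
  obtain ⟨L', h1', h2'⟩ := H'.exists_hasFDerivAt
  refine of_hasFDerivAt (h1.mul h1') ?_ (by rw [H.value, H'.value])
  rw [H.value, H'.value]
  exact h2.mul h2'

lemma sum {κ : Type*} {s : Finset κ} {F G : κ → Coord d → ℝ} (H : ∀ k, SameJet (F k) (G k) x) :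
    SameJet (fun y => ∑ k ∈ s, F k y) (fun y => ∑ k ∈ s, G k y) x := by
  classical
  induction s using Finset.induction_on with
  | empty => simpa using const 0
  | insert k s hk ih => simpa only [Finset.sum_insert hk] using (H k).add ih

lemma prod {κ : Type*} {s : Finset κ} {F G : κ → Coord d → ℝ} (H : ∀ k, SameJet (F k) (G k) x) :
    SameJet (fun y => ∏ k ∈ s, F k y) (fun y => ∏ k ∈ s, G k y) x := by
  classical
  induction s using Finset.induction_on with
  | empty => simpa using const 1
  | insert k s hk ih => simpa only [Finset.prod_insert hk] using (H k).mul ih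

lemma inv (H : SameJet f g x) (h0 : f x ≠ 0) :
    SameJet (fun y => (f y)⁻¹) (fun y => (g y)⁻¹) x := by
  obtain ⟨L, h1, h2⟩ := H.exists_hasFDerivAt
  refine of_hasFDerivAt ((hasDerivAt_inv h0).comp_hasFDerivAt x h1) ?_ (by rw [H.value])
  rw [H.value] at h0 ⊢
  exact (hasDerivAt_inv h0).comp_hasFDerivAt x h2

variable {ι : Type*} [Fintype ι] [DecidableEq ι] {h h' : Coord d → Matrix ι ι ℝ}

lemma det (H : ∀ a b, SameJet (fun y => h y a b) (fun y => h' y a b) x) :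
    SameJet (fun y => (h y).det) (fun y => (h' y).det) x := by
  simp only [Matrix.det_apply']
  exact .sum fun σ => (const _).mul (.prod fun k => H _ _)

/-- Invertibility is required of `h` at `x` only, because `h'` has the same value there. -/
lemma matrix_inv (H : ∀ a b, SameJet (fun y => h y a b) (fun y => h' y a b) x)
    (h0 : (h x).det ≠ 0) (a b : ι) :
    SameJet (fun y => (h y)⁻¹ a b) (fun y => (h' y)⁻¹ a b) x := by
  simp only [Matrix.inv_def, Matrix.smul_apply, smul_eq_mul, Ring.inverse_eq_inv',
    Matrix.adjugate_apply]
  refine ((det H).inv h0).mul (det fun c e => ?_)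
  by_cases hc : c = b
  · subst hc
    simpa only [Matrix.updateRow_self] using const _
  · simpa only [Matrix.updateRow_ne hc] using H c e

end SameJet

namespace SliceFields

lemma cov1_eq {C C' : Coord d → Fin d → Fin d → Fin d → ℝ} {ψ ψ' : Coord d → Fin d → ℝ}
    (hC : C x = C' x) (H : ∀ a, SameJet (fun y => ψ y a) (fun y => ψ' y a) x) (a b : Fin d) :
    cov1 spd C ψ x a b = cov1 spd C' ψ' x a b := by
  simp only [cov1, hC, (H _).spd_eq, (H _).value]

lemma div2_eq {h h' : Coord d → Matrix (Fin d) (Fin d) ℝ}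
    {C C' : Coord d → Fin d → Fin d → Fin d → ℝ} {ψ ψ' : Coord d → Fin d → Fin d → ℝ}
    (hh : h x = h' x) (hC : C x = C' x)
    (H : ∀ a b, SameJet (fun y => ψ y a b) (fun y => ψ' y a b) x) (b : Fin d) :
    div2 spd h C ψ x b = div2 spd h' C' ψ' x b := by
  simp only [div2, cov2, hh, hC, (H _ _).spd_eq, (H _ _).value]

/-- The value of `F` is determined by the values and the first derivatives of the fields. -/
theorem F_eq_of_sameFirstJet {Q Q' : SliceFields d} (hpos : (Q.h x).PosDef)
    (H : Q.SameFirstJet Q' x) (b : Fin d) : Q.F x b = Q'.F x b := by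
  have jI := SameJet.matrix_inv H.h hpos.det_pos.ne'
  have vh : Q.h x = Q'.h x := by ext a b; exact (H.h a b).value
  have vK : Q.K x = Q'.K x := by ext a b; exact (H.K a b).value
  have vS : Q.S x = Q'.S x := by ext a b c; exact (H.S a b c).value
  have vS0 : Q.S0 x = Q'.S0 x := by ext a b; exact (H.S0 a b).value
  have vSn : Q.Sn x = Q'.Sn x := by ext a; exact (H.Sn a).value
  have vacc : Q.acc x = Q'.acc x := by ext a; exact (H.acc a).value
  have vshift : Q.shift x = Q'.shift x := by ext a; exact (H.shift a).value
  have jT : ∀ a, SameJet (fun y => Q.trS y a) (fun y => Q'.trS y a) x :=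
    fun a => .sum fun i => H.S a i i
  have vT : Q.trS x = Q'.trS x := by ext a; exact (jT a).value
  have jL : ∀ a b c, SameJet (fun y => lowerTorsion Q.h Q.S y a b c)
      (fun y => lowerTorsion Q'.h Q'.S y a b c) x :=
    fun a b c => .sum fun s => (H.h c s).mul (H.S a b s)
  have jC : ∀ a b c, SameJet (fun y => Q.contor y a b c) (fun y => Q'.contor y a b c) x :=
    fun a b c => ((H.S a b c).add <| .sum fun s => (jI c s).mul (jL s a b)).sub <|
      .sum fun s => (jI c s).mul (jL b s a)
  have vC : Q.contor x = Q'.contor x := by ext a b c; exact (jC a b c).value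
  -- Only the value of the connection is determined, as it already contains `∂h`. This suffices
  -- because `F` never differentiates it; the contorsion, which is differentiated, is algebraic in
  -- `h` and `S`.
  have vconn : Q.conn x = Q'.conn x := by
    ext a b c
    have e : christoffel spd Q.h x a b c = christoffel spd Q'.h x a b c := by
      simp only [christoffel, vh, (H.h _ _).spd_eq]
    exact congrArg₂ (· + ·) e (jC a b c).value
  have jR : ∀ a b, SameJet (fun y => raise2 Q.h Q.K y a b) (fun y => raise2 Q'.h Q'.K y a b) x :=
    fun a b => .sum fun c => (jI b c).mul (H.K a c)
  have jinner : ∀ a b, SameJet (fun y => Q.inner y a b) (fun y => Q'.inner y a b) x := fun a b =>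
    (((SameJet.const 2).mul (.sum fun j => (H.S a b j).mul (jT j))).add
      (((H.Sn a).mul (H.acc b)).sub ((H.Sn b).mul (H.acc a)))).add
      (.sum fun i => ((H.S0 a i).mul (jR b i)).sub ((H.S0 b i).mul (jR a i)))
  have jCT : ∀ a b, SameJet (fun y => Q.contorTrS y a b) (fun y => Q'.contorTrS y a b) x :=
    fun a b => .sum fun j => (jC a b j).mul (jT j)
  have vlie : ∀ a b, Q.lieZeroK x a b = Q'.lieZeroK x a b := by
    intro a b
    simp only [lieZeroK, vshift, vK, (H.K _ _).pd_eq, (H.K _ _).spd_eq, (H.shift _).spd_eq]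
  have vbracket : ∀ a b, Q.bracket x a b = Q'.bracket x a b := by
    intro a b
    simp only [bracket, raise2, trace2, vh, vK, vS0, vSn, vacc, H.lapse.value, vlie,
      cov1_eq vconn H.acc]
  simp only [F, raise1, vbracket, vh, vC, vT, vS, cov1_eq vconn jT, div2_eq vh vconn jinner,
    div2_eq vh vconn jCT]

end SliceFields

end Jets

/-! ### The constraint -/

section Constraint

variable {d : ℕ} {U : Set (Coord d)} {g : Coord d → Matrix (Fin (d + 1)) (Fin (d + 1)) ℝ}
  {S : Coord d → Fin (d + 1) → Fin (d + 1) → Fin (d + 1) → ℝ} {n : Coord d → Fin (d + 1) → ℝ}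
  {lapse : Coord d → ℝ} {shift : Coord d → Fin d → ℝ} {x : Coord d}

lemma trace2_metric {ι X : Type*} [Fintype ι] [DecidableEq ι] {h : X → Matrix ι ι ℝ} {x : X}
    (h0 : IsUnit (h x).det) (hs : ∀ a b, h x a b = h x b a) :
    ∑ a, ∑ b, (h x)⁻¹ a b * h x a b = Fintype.card ι := by
  have : ∀ a, ∑ b, (h x)⁻¹ a b * h x a b = 1 := by
    intro a
    simp only [hs a, sum_inv_mul h0, if_true]
  simp [this]

/-- Trace of the Einstein tensor. -/
lemma trace2_einstein {ι X : Type*} [Fintype ι] [DecidableEq ι] {D : ι → (X → ℝ) → X → ℝ}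
    {h : X → Matrix ι ι ℝ} {C : X → ι → ι → ι → ℝ} {x : X}
    (h0 : IsUnit (h x).det) (hs : ∀ a b, h x a b = h x b a) :
    trace2 h (einstein D h C) x
      = (1 - Fintype.card ι / 2) * trace2 h (ricci D C) x := by
  have e : trace2 h (einstein D h C) x = trace2 h (ricci D C) x
      - 1 / 2 * trace2 h (ricci D C) x * ∑ a, ∑ b, (h x)⁻¹ a b * h x a b := by
    simp only [Finset.mul_sum, trace2, einstein, mul_sub, Finset.sum_sub_distrib]
    congr 1
    refine Finset.sum_congr rfl fun a _ => Finset.sum_congr rfl fun b _ => ?_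
    simp only [← Finset.mul_sum]
    ring
  rw [e, trace2_metric h0 hs]
  ring

namespace AdaptedFields

variable (H : AdaptedFields U g S n lapse shift)
include H

lemma inducedMetric_symm (y : Coord d) (a b : Fin d) :
    inducedMetric g y a b = inducedMetric g y b a := H.symm y _ _

lemma inducedTorsion_antisymm (y : Coord d) (a b c : Fin d) :
    inducedTorsion g S y a b c = -inducedTorsion g S y b a c := by
  simp only [inducedTorsion, ← Finset.sum_neg_distrib]
  exact Finset.sum_congr rfl fun γ _ => by rw [H.antisymm y a.succ b.succ γ]; ring

lemma smoothOn_inducedMetric (a b : Fin d) : SmoothOn U fun y => inducedMetric g y a b :=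
  H.smoothMetric _ _

lemma smoothOn_inducedTorsion (a b c : Fin d) : SmoothOn U fun y => inducedTorsion g S y a b c :=
  .sum fun γ => (SmoothOn.sum fun i => (SmoothOn.matrix_inv H.smoothOn_inducedMetric
    (fun _ hy => H.isUnit_det_inducedMetric hy) c i).mul (H.smoothMetric i.succ γ)).mul
      (H.smoothTorsion a.succ b.succ γ)

lemma smoothOn_torsion0ab (a b : Fin d) : SmoothOn U fun y => torsion0ab g S n y a b :=
  .sum fun μ => (H.smoothOn_normal μ).mul
    (smoothOn_lowerTorsion H.smoothMetric H.smoothTorsion μ a.succ b.succ)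

lemma smoothOn_torsiona00 (a : Fin d) : SmoothOn U fun y => torsiona00 g S n y a :=
  .sum fun μ => .sum fun ν => ((H.smoothOn_normal μ).mul (H.smoothOn_normal ν)).mul
    (smoothOn_lowerTorsion H.smoothMetric H.smoothTorsion a.succ μ ν)

lemma smoothOn_ricci (a b : Fin (d + 1)) :
    SmoothOn U fun y => ricci pd (connection pd g S) y a b := by
  have sC := H.smoothOn_conn
  have sD : ∀ μ a b c, SmoothOn U fun y => pd μ (fun z => connection pd g S z a b c) y :=
    fun μ a b c => (sC a b c).dirDeriv H.isOpen (coordDir d) μ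
  exact .sum fun c => ((sD c a b c).sub (sD a c b c)).add <| .sum fun s =>
    ((sC c s c).mul (sC a b s)).sub ((sC a s c).mul (sC c b s))

/-- The constraint with the field equations replaced by the Ricci tensor of the spacetime. -/
theorem ricci_constraint (hd : 3 ≤ d) (h0 : ∀ y ∈ U, ∀ a b, torsionab0 g S n y a b = 0)
    (hx : x ∈ U) (P : SliceFields d) (hP : P = sliceFields g S n lapse shift) (N : ℝ)
    (hN : N = ((d + 1 : ℕ) : ℝ)) (b : Fin d) :
    P.laplaceTrS x b - P.gradDivTrS x b
        + (N - 2) / (N - 3) * (div2 spd P.h P.conn P.divTracelessS x b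
          - div2 spd P.h P.conn (asym (cov1 spd P.conn P.acc)) x b)
        + P.F x b
      = (N - 2) / (N - 3) * div2 spd P.h P.conn
          (asym fun y a b => ricci pd (connection pd g S) y a.succ b.succ) x b
        + ∑ j, raise1 P.h P.trS x j * ricci pd (connection pd g S) x b.succ j.succ := by
  have hdR : (3 : ℝ) ≤ d := by exact_mod_cast hd
  have hN2 : N - 2 ≠ 0 := by rw [hN]; push_cast; linarith
  have hN3 : N - 3 ≠ 0 := by rw [hN]; push_cast; linarith
  subst hP
  set P := sliceFields g S n lapse shift with hP
  have hU := H.isOpen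
  have hdet : ∀ y ∈ U, IsUnit (P.h y).det := fun y hy => H.isUnit_det_inducedMetric hy
  have sh : ∀ a b, SmoothOn U fun y => P.h y a b := H.smoothOn_inducedMetric
  have sS : ∀ a b c, SmoothOn U fun y => P.S y a b c := H.smoothOn_inducedTorsion
  have hS : ∀ y a b c, P.S y a b c = -P.S y b a c := H.inducedTorsion_antisymm
  have hs : ∀ y a b, P.h y a b = P.h y b a := H.inducedMetric_symm
  have sT : ∀ a, SmoothOn U fun y => P.trS y a := fun a => .sum fun i => sS a i i
  have sC : ∀ a b c, SmoothOn U fun y => P.conn y a b c :=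
    smoothOn_connection (v := sliceDir d) hU hdet sh sS
  have sσ : ∀ a b, SmoothOn U fun y => cov1 spd P.conn P.trS y a b :=
    smoothOn_cov1 (v := sliceDir d) hU sC sT
  have sacc : ∀ a b, SmoothOn U fun y => cov1 spd P.conn P.acc y a b :=
    smoothOn_cov1 (v := sliceDir d) hU sC H.smoothOn_acceleration
  have compat : ∀ y ∈ U, CompatibleAt spd P.h P.conn y := fun y hy =>
    compatibleAt_connection (hdet y hy) hs (hS y)
  have slow : ∀ a b c, SmoothOn U fun y => P.tracelessS y a b c := fun a b c =>
    (smoothOn_lowerTorsion sh sS a b c).add <| (SmoothOn.const _).mul <|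
      ((sh c a).mul (sT b)).sub ((sh c b).mul (sT a))
  have sdiv : ∀ a b, SmoothOn U fun y => P.divTracelessS y a b := fun a b =>
    .sum fun i => .sum fun j => (SmoothOn.matrix_inv sh hdet i j).mul
      (smoothOn_cov3 (v := sliceDir d) hU sC slow i a b j)
  have sR2 : ∀ a b, SmoothOn U fun y => raise2 P.h P.K y a b := fun a b =>
    .sum fun c => (SmoothOn.matrix_inv sh hdet b c).mul (H.smoothOn_secondForm a c)
  have sS0 : ∀ a b, SmoothOn U fun y => P.S0 y a b := H.smoothOn_torsion0ab
  have sSn : ∀ a, SmoothOn U fun y => P.Sn y a := H.smoothOn_torsiona00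
  have sin : ∀ a b, SmoothOn U fun y => P.inner y a b := fun a b =>
    (((SmoothOn.const 2).mul (.sum fun j => (sS a b j).mul (sT j))).add
      (((sSn a).mul (H.smoothOn_acceleration b)).sub
        ((sSn b).mul (H.smoothOn_acceleration a)))).add
      (.sum fun i => ((sS0 a i).mul (sR2 b i)).sub ((sS0 b i).mul (sR2 a i)))
  have sas : ∀ a b, SmoothOn U fun y => asym (cov1 spd P.conn P.acc) y a b := fun a b =>
    (SmoothOn.const _).mul ((sacc a b).sub (sacc b a))
  -- The terms in `K_{ab} K`, `K^i_a K_{bi}`, `a_a a_b` and `ℒ_0 K` are symmetric and cancel. The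
  -- subtracted torsion product is the part of `inner` that comes from the Bianchi identity instead.
  have hbr : ∀ y ∈ U, ∀ a b, 1 / 2 * (P.bracket y b a - P.bracket y a b)
      = P.inner y a b - 2 * ∑ j, P.S y a b j * P.trS y j - asym (cov1 spd P.conn P.acc) y a b := by
    intro y hy a b
    have r1 := H.ricci_succ h0 hy a b
    have hK : ∀ a b, P.K y a b = P.K y b a := fun a b => H.secondForm_symm h0 hy a b
    have kk : ∑ i, ∑ j, (P.h y)⁻¹ i j * P.K y j b * P.K y a i
        = ∑ i, ∑ j, (P.h y)⁻¹ i j * P.K y j a * P.K y b i := by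
      rw [Finset.sum_comm]
      refine Finset.sum_congr rfl fun i _ => Finset.sum_congr rfl fun j _ => ?_
      rw [inv_symm (hs y) j i, hK i b, hK a j]
      ring
    have lie : P.lieZeroK y b a = P.lieZeroK y a b := H.lieZeroK_symm h0 hy b a
    simp only [SliceFields.bracket, SliceFields.inner, asym, kk, lie, hK b a,
      Finset.sum_sub_distrib]
    ring
  -- Bianchi and Gauss combined; `(N - 3) / (N - 2)` is `1 - 1 / (N - 2)`. Differences are written
  -- with a factor `-1` so that additivity and homogeneity of the divergence suffice afterwards.
  have key : ∀ y ∈ U, ∀ a b, asym (fun y a b => ricci pd (connection pd g S) y a.succ b.succ) y a b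
      = (P.divTracelessS y a b + P.inner y a b)
        + (-1 * asym (cov1 spd P.conn P.acc) y a b
          + (N - 3) / (N - 2) * (cov1 spd P.conn P.trS y a b
            + -1 * cov1 spd P.conn P.trS y b a)) := by
    intro y hy a b
    have r := ricci_antisymm (v := sliceDir d) hU hy compat (hdet y hy) sh sC sS
      (fun z _ => connection_torsion hs (hS z)) a b
    have t := sum_inv_cov3_traceless (v := sliceDir d) (compat y hy) (hdet y hy)
      (fun a b => (sh a b).differentiableAt hU hy)
      (fun a b c => (sS a b c).differentiableAt hU hy)
      (fun a => (sT a).differentiableAt hU hy) (1 / (N - 2)) a b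
    have t' : P.divTracelessS y a b = divTorsion spd P.conn P.S y a b
        + 1 / (N - 2) * (cov1 spd P.conn P.trS y a b - cov1 spd P.conn P.trS y b a) := by
      rw [hN] at t ⊢
      exact t
    have r' : ricci spd P.conn y a b - ricci spd P.conn y b a
        = 2 * (divTorsion spd P.conn P.S y a b
          + (cov1 spd P.conn P.trS y a b - cov1 spd P.conn P.trS y b a)
          + 2 * ∑ j, P.S y a b j * P.trS y j) := r
    have q := hbr y hy a b
    have e : asym (fun y a b => ricci pd (connection pd g S) y a.succ b.succ) y a b
        = 1 / 2 * (ricci spd P.conn y a b - ricci spd P.conn y b a)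
          + 1 / 2 * (P.bracket y b a - P.bracket y a b) := by
      rw [asym, H.ricci_succ h0 hy, H.ricci_succ h0 hy]
      ring
    rw [e, q, r', t']
    field_simp
    ring
  have dd := fun {f : Coord d → ℝ} (hf : SmoothOn U f) => hf.differentiableAt hU hx
  have div : div2 spd P.h P.conn
        (asym fun y a b => ricci pd (connection pd g S) y a.succ b.succ) x b
      = (div2 spd P.h P.conn P.divTracelessS x b + div2 spd P.h P.conn P.inner x b)
        + (-1 * div2 spd P.h P.conn (asym (cov1 spd P.conn P.acc)) x b
          + (N - 3) / (N - 2) * (div2 spd P.h P.conn (cov1 spd P.conn P.trS) x b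
            + -1 * div2 spd P.h P.conn (fun y a b => cov1 spd P.conn P.trS y b a) x b)) := by
    have c1 := div2_const_mul (v := sliceDir d) (h := P.h) (C := P.conn) (-1)
      (fun a b => dd (sσ b a)) b
    have c2 := div2_add (v := sliceDir d) (h := P.h) (C := P.conn) (fun a b => dd (sσ a b))
      (fun a b => (dd (sσ b a)).const_mul (-1)) b
    have c3 := div2_const_mul (v := sliceDir d) (h := P.h) (C := P.conn) ((N - 3) / (N - 2))
      (fun a b => (dd (sσ a b)).fun_add ((dd (sσ b a)).const_mul (-1))) b
    have c4 := div2_const_mul (v := sliceDir d) (h := P.h) (C := P.conn) (-1)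
      (fun a b => dd (sas a b)) b
    have c5 := div2_add (v := sliceDir d) (h := P.h) (C := P.conn)
      (fun a b => (dd (sas a b)).const_mul (-1))
      (fun a b => ((dd (sσ a b)).fun_add ((dd (sσ b a)).const_mul (-1))).const_mul
        ((N - 3) / (N - 2))) b
    have c6 := div2_add (v := sliceDir d) (h := P.h) (C := P.conn)
      (fun a b => dd (sdiv a b)) (fun a b => dd (sin a b)) b
    have c7 := div2_add (v := sliceDir d) (h := P.h) (C := P.conn)
      (fun a b => (dd (sdiv a b)).fun_add (dd (sin a b)))
      (fun a b => ((dd (sas a b)).const_mul (-1)).fun_add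
        (((dd (sσ a b)).fun_add ((dd (sσ b a)).const_mul (-1))).const_mul
        ((N - 3) / (N - 2)))) b
    rw [c6, c5, c4, c3, c2, c1] at c7
    exact (div2_congr (v := sliceDir d) hU hx key b).trans c7
  have slice := torsion_trace_identity (v := sliceDir d) hU hx hdet hs hS sh sS
    (σ := P.trS) rfl (C := P.conn) rfl b
  have slice' : P.laplaceTrS x b - P.gradDivTrS x b
      = div2 spd P.h P.conn (cov1 spd P.conn P.trS) x b
        - div2 spd P.h P.conn (fun y a b => cov1 spd P.conn P.trS y b a) x b
        + ∑ j, ricci spd P.conn x b j * raise1 P.h P.trS x j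
        + 2 * ∑ j, ∑ l, ∑ k, (P.h x)⁻¹ j l * P.S x b l k * cov1 spd P.conn P.trS x k j
        + div2 spd P.h P.conn P.contorTrS x b
        + 2 * ∑ j, raise1 P.h P.trS x j * cov1 spd P.conn P.trS x j b
        + 2 * ∑ k, ∑ j, P.contor x k b j * raise1 P.h P.trS x k * P.trS x j
        + ∑ k, ∑ l, ∑ j, (P.h x)⁻¹ k l * P.contor x k b j * cov1 spd P.conn P.trS x l j
        + ∑ c, ∑ e, ∑ k, ∑ j, (P.h x)⁻¹ c e * P.contor x c b k * P.contor x e k j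
          * P.trS x j := slice
  -- Second use of the Gauss equation, now on the Ricci term from commuting derivatives; its index
  -- order `bracket x j b` is the one in `F`.
  have ric : ∑ j, raise1 P.h P.trS x j * ricci pd (connection pd g S) x b.succ j.succ
      = ∑ j, ricci spd P.conn x b j * raise1 P.h P.trS x j
        + ∑ a, P.bracket x a b * raise1 P.h P.trS x a := by
    rw [← Finset.sum_add_distrib]
    exact Finset.sum_congr rfl fun j _ => by rw [H.ricci_succ h0 hx]; ring
  rw [slice', div, ric, SliceFields.F, ← hN]
  field_simp
  ring

end AdaptedFields

end Constraint

/-! ### From fields on the manifold to components in a chart -/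

section Chart

variable {d : ℕ} {M : Type*} [TopologicalSpace M] [ChartedSpace (Coord d) M]

/-- Linearity of the derivative of the chart suffices, so this holds at every `x`, also outside
`φ.target`; `AdaptedFields` asks for the symmetries everywhere. -/
lemma bilinComp_antisymm {S : BilinField d M} (hS : IsTorsion S)
    (φ : OpenPartialHomeomorph M (Coord d)) (x : Coord d) (α β γ : Fin (d + 1)) :
    bilinComp φ S x α β γ = -bilinComp φ S x β α γ := by
  have h := hS.antisymm (φ.symm x) (coordVec φ x α) (coordVec φ x β)
  simp only [bilinComp, vecComp, h, map_neg]
  rfl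

lemma adaptedFields_of_chart {g : FormField d M} {S : BilinField d M} (hg : IsLorentzMetric g)
    (hS : IsTorsion S) {φ : OpenPartialHomeomorph M (Coord d)}
    (hφ : φ ∈ IsManifold.maximalAtlas (𝓡 (d + 1)) ∞ M) {n : Coord d → Fin (d + 1) → ℝ}
    {lapse : Coord d → ℝ} {shift : Coord d → Fin d → ℝ}
    (hn : IsAdapted (formComp φ g) n φ.target lapse shift) :
    AdaptedFields φ.target (formComp φ g) (bilinComp φ S) n lapse shift where
  isOpen := φ.open_target
  symm _ _ _ := hg.symm _ _ _
  antisymm := bilinComp_antisymm hS φ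
  smoothMetric := hg.smooth φ hφ
  smoothTorsion := hS.smooth φ hφ
  adapted := hn

end Chart

end EinsteinCartan

end

/-! ### The constraint for Einstein-Cartan spacetimes -/

theorem mainTheorem7 {d : ℕ} (hN : 3 < d + 1)
    {M : Type*} [TopologicalSpace M] [ChartedSpace (EinsteinCartan.Coord d) M]
    [IsManifold (𝓡 (d + 1)) ∞ M]
    (g : EinsteinCartan.FormField d M) (S : EinsteinCartan.BilinField d M)
    (T : EinsteinCartan.FormField d M) (Λ : ℝ)
    (hg : EinsteinCartan.IsLorentzMetric g) (hS : EinsteinCartan.IsTorsion S)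
    (hT : EinsteinCartan.FieldEquations g S T Λ)
    (φ : OpenPartialHomeomorph M (EinsteinCartan.Coord d))
    (hφ : φ ∈ IsManifold.maximalAtlas (𝓡 (d + 1)) ∞ M)
    (n : EinsteinCartan.Coord d → Fin (d + 1) → ℝ)
    (lapse : EinsteinCartan.Coord d → ℝ) (shift : EinsteinCartan.Coord d → Fin d → ℝ)
    (hn : EinsteinCartan.IsAdapted (EinsteinCartan.formComp φ g) n φ.target lapse shift)
    (hab0 : ∀ x ∈ φ.target, ∀ a b : Fin d, EinsteinCartan.torsionab0
      (EinsteinCartan.formComp φ g) (EinsteinCartan.bilinComp φ S) n x a b = 0)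
    (P : EinsteinCartan.SliceFields d)
    (hP : P = EinsteinCartan.sliceFields
      (EinsteinCartan.formComp φ g) (EinsteinCartan.bilinComp φ S) n lapse shift)
    (Tab : EinsteinCartan.Coord d → Fin d → Fin d → ℝ)
    (hTab : Tab = fun x a b => EinsteinCartan.formComp φ T x a.succ b.succ)
    (trT : EinsteinCartan.Coord d → ℝ)
    (htrT : trT = EinsteinCartan.trace2
      (EinsteinCartan.formComp φ g) (EinsteinCartan.formComp φ T))
    (N : ℝ) (hNd : N = ((d + 1 : ℕ) : ℝ)) :
    (∀ x ∈ φ.target, ∀ b : Fin d,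
      P.laplaceTrS x b - P.gradDivTrS x b
        + (N - 2) / (N - 3) *
            (EinsteinCartan.div2 EinsteinCartan.spd P.h P.conn P.divTracelessS x b
              - EinsteinCartan.div2 EinsteinCartan.spd P.h P.conn
                  (EinsteinCartan.asym (EinsteinCartan.cov1 EinsteinCartan.spd P.conn P.acc)) x b)
        + P.F x b
      = (N - 2) / (N - 3) * (8 * Real.pi) *
            EinsteinCartan.div2 EinsteinCartan.spd P.h P.conn (EinsteinCartan.asym Tab) x b
          + 8 * Real.pi * ∑ j, EinsteinCartan.raise1 P.h P.trS x j * Tab x b j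
          + P.trS x b * (2 / (N - 2) * Λ - 8 * Real.pi / (N - 2) * trT x))
    ∧ ∀ (Q Q' : EinsteinCartan.SliceFields d) (x : EinsteinCartan.Coord d),
        (Q.h x).PosDef → Q.SameFirstJet Q' x → ∀ b : Fin d, Q.F x b = Q'.F x b := by
  have H := EinsteinCartan.adaptedFields_of_chart hg hS hφ hn
  refine ⟨fun x hx b => ?_, fun Q Q' x hpos hQ b =>
    EinsteinCartan.SliceFields.F_eq_of_sameFirstJet hpos hQ b⟩
  set G := EinsteinCartan.formComp φ g with hG
  set C := EinsteinCartan.connection EinsteinCartan.pd G (EinsteinCartan.bilinComp φ S) with hC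
  have hπ : (8 * Real.pi) ≠ 0 := by positivity
  have hN2 : N - 2 ≠ 0 := by
    have : (3 : ℝ) ≤ d := by exact_mod_cast Nat.lt_succ_iff.1 hN
    rw [hNd]
    push_cast
    linarith
  have hE : ∀ y ∈ φ.target, ∀ μ ν, 8 * Real.pi * EinsteinCartan.formComp φ T y μ ν
      = EinsteinCartan.einstein EinsteinCartan.pd G C y μ ν + G y μ ν * Λ := by
    intro y hy μ ν
    rw [hT φ hφ y hy μ ν]
    ring
  set R := EinsteinCartan.trace2 G (EinsteinCartan.ricci EinsteinCartan.pd C) with hR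
  -- The traced field equations, which determine the scalar curvature because `N ≠ 2`.
  have htr : 8 * Real.pi * trT x = (1 - N / 2) * R x + N * Λ := by
    have e1 : 8 * Real.pi * trT x = EinsteinCartan.trace2 G
        (EinsteinCartan.einstein EinsteinCartan.pd G C) x
          + (∑ μ, ∑ ν, (G x)⁻¹ μ ν * G x μ ν) * Λ := by
      simp only [htrT, EinsteinCartan.trace2, Finset.mul_sum, Finset.sum_mul,
        ← Finset.sum_add_distrib]
      refine Finset.sum_congr rfl fun μ _ => Finset.sum_congr rfl fun ν _ => ?_
      linear_combination (G x)⁻¹ μ ν * hE x hx μ ν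
    rw [e1, EinsteinCartan.trace2_einstein (H.isUnit_det hx) (H.symm x),
      EinsteinCartan.trace2_metric (H.isUnit_det hx) (H.symm x), Fintype.card_fin, hNd]
  -- The terms proportional to the metric are symmetric, so the antisymmetric part of `8π 𝒯` is that
  -- of the Ricci tensor. Equality on the whole chart domain is needed before taking the divergence.
  have has : EinsteinCartan.div2 EinsteinCartan.spd P.h P.conn (EinsteinCartan.asym Tab) x b
      = 1 / (8 * Real.pi) * EinsteinCartan.div2 EinsteinCartan.spd P.h P.conn
        (EinsteinCartan.asym fun y a b =>
          EinsteinCartan.ricci EinsteinCartan.pd C y a.succ b.succ) x b := by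
    have sR : ∀ a b : Fin d, DifferentiableAt ℝ (fun y => EinsteinCartan.asym (fun y a b =>
        EinsteinCartan.ricci EinsteinCartan.pd C y a.succ b.succ) y a b) x := fun a b =>
      (((H.smoothOn_ricci a.succ b.succ).sub (H.smoothOn_ricci b.succ a.succ)).differentiableAt
        H.isOpen hx).const_mul (1 / 2)
    refine (EinsteinCartan.div2_congr (v := EinsteinCartan.sliceDir d) H.isOpen hx
      (fun y hy a b => ?_) b).trans
      (EinsteinCartan.div2_const_mul (v := EinsteinCartan.sliceDir d) _ sR b)
    have e1 := hE y hy a.succ b.succ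
    have e2 := hE y hy b.succ a.succ
    simp only [EinsteinCartan.einstein, H.symm y b.succ a.succ] at e1 e2
    simp only [EinsteinCartan.asym, hTab]
    field_simp
    linear_combination e1 - e2
  -- Here the metric terms do survive: contracted with `σ^j` they give `σ_b` times `Λ - R / 2`, and
  -- `R` is then eliminated by `htr`.
  have hsum : 8 * Real.pi * ∑ j, EinsteinCartan.raise1 P.h P.trS x j * Tab x b j
      = ∑ j, EinsteinCartan.raise1 P.h P.trS x j
          * EinsteinCartan.ricci EinsteinCartan.pd C x b.succ j.succ
        + P.trS x b * (Λ - 1 / 2 * R x) := by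
    have low : ∑ j, P.h x b j * EinsteinCartan.raise1 P.h P.trS x j = P.trS x b := by
      rw [hP]
      exact EinsteinCartan.sum_lower_inv (H.isUnit_det_inducedMetric hx) _ b
    rw [← low, Finset.mul_sum, Finset.sum_mul, ← Finset.sum_add_distrib]
    refine Finset.sum_congr rfl fun j _ => ?_
    have e := hE x hx b.succ j.succ
    have e' : P.h x b j = G x b.succ j.succ := by rw [hP]; rfl
    rw [EinsteinCartan.einstein] at e
    rw [hTab, e']
    linear_combination EinsteinCartan.raise1 P.h P.trS x j * e
  rw [H.ricci_constraint (Nat.lt_succ_iff.1 hN) hab0 hx P hP N hNd b, has, hsum]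
  have ht : 8 * Real.pi / (N - 2) * trT x = ((1 - N / 2) * R x + N * Λ) / (N - 2) := by
    rw [← htr]
    ring
  rw [ht]
  field_simp
  ring
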